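/- Let $\{X_{i,k}: i\ge 1,\ k\ge 1\}$ be an array of i.i.d. real random variables on one probability space, with finite mean and with variance $0<\operatorname{Var}(X_{1,1})<\infty$. Let $q\ge 1$ be a real number and let $\{p_n\}_{n\ge 1}$ be positive integers. For $n\ge1$ with $p_n\ge 2$ let $$M_{n,q}=\max_{1\le i<j\le p_n}\Big(\sum_{k=1}^n |X_{i,k}-X_{j,k}|^q\Big)^{1/q}$$ be the maximum interpoint $l^q$-distance between the rows of the $p_n\times n$ matrix $(X_{i,k})_{1\le i\le p_n,\,1\le k\le n}$. Assume that, for some $\tau>0$ and some constants $c_1,c_2$ not depending on $n$, (i) $0<c_1\le p_n/n^{\tau}\le c_2<\infty$ for all $n\ge 1$; (ii) $E|X_{1,1}|^{q(4\tau+4+\epsilon)}<\infty$ for some $\epsilon>0$; (iii) $\mathrm{Corr}\big(|X_{1,1}-X_{2,1}|^q,\,|X_{1,1}-X_{3,1}|^q\big)<1/3$. Then, as $n\to\infty$, $$\frac{M_{n,q}^q-n\,E|X_{1,1}-X_{2,1}|^q}{\sqrt{\operatorname{Var}\big(|X_{1,1}-X_{2,1}|^q\big)\,n\log p_n}}\longrightarrow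 2\quad\text{almost surely.}$$ -/

import Mathlib

open MeasureTheory ProbabilityTheory Filter Topology

/-- Correlation coefficient of two real random variables. -/
noncomputable def corr {Ω : Type*} [MeasurableSpace Ω] (Y Z : Ω → ℝ) (μ : Measure Ω) : ℝ :=
  covariance Y Z μ / (Real.sqrt (variance Y μ) * Real.sqrt (variance Z μ))

/-- The `l^q` norm of a vector of `ℝⁿ`. -/
noncomputable def lqNorm {n : ℕ} (q : ℝ) (x : Fin n → ℝ) : ℝ :=
  (∑ k, |x k| ^ q) ^ (1 / q)

/-- The maximum interpoint `l^q` distance: the maximum, over all pairs of rows `i < j` of a real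
`p × n` matrix, of the `l^q` norm of the difference of the two rows. It is the supremum of a finite
family, so it is a maximum as soon as there are two rows. -/
noncomputable def maxInterpointDist {p n : ℕ} (q : ℝ) (A : Matrix (Fin p) (Fin n) ℝ) : ℝ :=
  ⨆ ij : {ij : Fin p × Fin p // ij.1 < ij.2}, lqNorm q (A ij.1.1 - A ij.1.2)

/-- The `p × n` upper left corner of an infinite array of real random variables, at the sample
point `ω`. Rows and columns are numbered from `0`. -/
def dataMatrix {Ω : Type*} (X : ℕ → ℕ → Ω → ℝ) (p n : ℕ) (ω : Ω) : Matrix (Fin p) (Fin n) ℝ :=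
  Matrix.of fun i k => X i k ω

/-! The `q`-th power of the distance between two rows is a sum of `n` i.i.d. nonnegative terms with
mean `m` and variance `v`. Such a sum exceeds `n m` by `y √(n log n)` with probability `n ^ (-z +
o(1))`, where `z = y² / (2 v)`. There are about `n ^ (2 τ)` pairs of rows, so the critical level is
`z = 2 τ`, that is `y = 2 √(v τ)`. Since `log (p n) ~ τ log n`, the normalised limit is `2`.

Above the critical level a union bound suffices (`eventually_measureReal_sum_min_le`, a Chernoff
bound after truncation at `N ^ s`, `s < 1/2`). Below it the second moment method is used
(`measureReal_forall_notMem_le`). Pairs without a common row are independent. For two pairs sharing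
a row, covariance below `v / 3` makes the variance of the two added terms less than `8 v / 3`, so
the joint probability is about `n ^ (-3 z / 2)` at most. The `n ^ (3 τ)` such couples then
contribute relative variance `n ^ (z / 2 - τ)`, which vanishes exactly when `z < 2 τ`. The matching
lower bound for one pair comes from the central limit theorem applied to blocks
(`eventually_rpow_le_measureReal_sum`).

Near the critical level these bounds decay only like a small power of `n`, so Borel–Cantelli is
applied along `N = ⌈ρ ^ k⌉`. Between `N` and `ρ N` the increments have variance at most `(ρ - 1) N
v`; for `ρ` near `1` their tails beat a union bound over all pairs and all `n` in the block. -/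

/-! ### Chernoff bounds for variables bounded above. -/

/-- The factor `1 + B` tends to `1` with `B`, so the sharp constant `1/2` in front of the variance
survives. Only an upper bound on `u` is needed. -/
theorem exp_le_one_add_add_sq {u B : ℝ} (hu : u ≤ B) (hB : 0 ≤ B) (hB1 : B ≤ 1) :
    Real.exp u ≤ 1 + u + u ^ 2 / 2 * (1 + B) := by
  rcases le_total 0 u with h | h
  · have h1 := Real.exp_bound' h (hu.trans hB1) (n := 3) (by norm_num)
    have : u ^ 3 ≤ u ^ 2 * B := by
      rw [pow_succ]; gcongr
    norm_num [Finset.sum_range_succ, Nat.factorial] at h1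
    have : 0 ≤ u ^ 2 * B := by positivity
    nlinarith
  · have h1 := Real.quadratic_le_exp_of_nonneg (neg_nonneg.2 h)
    have h2 : Real.exp u * Real.exp (-u) = 1 := by rw [← Real.exp_add]; simp
    have h3 : Real.exp u ≤ 1 + u + u ^ 2 / 2 := by
      have h4 : 0 < Real.exp u := Real.exp_pos u
      have h5 : Real.exp u * (1 + -u + (-u) ^ 2 / 2) ≤ 1 :=
        (mul_le_mul_of_nonneg_left h1 h4.le).trans_eq h2
      have h6 : 0 < 1 + -u + (-u) ^ 2 / 2 := by nlinarith
      -- The product equals `1 + u⁴ / 4`.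
      have h7 : 1 ≤ (1 + u + u ^ 2 / 2) * (1 + -u + (-u) ^ 2 / 2) := by nlinarith [sq_nonneg (u^2)]
      exact le_of_mul_le_mul_right (h5.trans h7) h6
    nlinarith [mul_nonneg (sq_nonneg u) hB]

theorem mgf_le_exp_of_le {Ω : Type*} [MeasurableSpace Ω] {μ : Measure Ω} [IsProbabilityMeasure μ]
    {V : Ω → ℝ} (hV : MemLp V 2 μ) {v B t : ℝ} (hB : 0 ≤ B) (hB1 : B ≤ 1) (ht : 0 ≤ t)
    (hle : ∀ ω, t * V ω ≤ B) (hmean : ∫ ω, V ω ∂μ ≤ 0) (hsq : ∫ ω, V ω ^ 2 ∂μ ≤ v) :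
    mgf V μ t ≤ Real.exp (t ^ 2 * v * (1 + B) / 2) := by
  have hi : Integrable V μ := hV.integrable (by norm_num)
  have hi2 : Integrable (fun ω => V ω ^ 2) μ := hV.integrable_sq
  have ia : Integrable (fun ω => 1 + t * V ω) μ := (integrable_const _).add (hi.const_mul _)
  have h1 : mgf V μ t ≤ ∫ ω, (1 + t * V ω + (t ^ 2 * (1 + B) / 2) * V ω ^ 2) ∂μ := by
    refine integral_mono_of_nonneg (ae_of_all _ fun ω => (Real.exp_pos _).le) ?_
      (ae_of_all _ fun ω => ?_)
    · exact ia.add (hi2.const_mul _)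
    · have := exp_le_one_add_add_sq (hle ω) hB hB1
      simp only
      linarith [this, mul_pow t (V ω) 2]
  rw [integral_add ia (hi2.const_mul _),
    integral_add (integrable_const _) (hi.const_mul _), integral_const_mul, integral_const_mul] at h1
  simp only [integral_const, probReal_univ, smul_eq_mul, mul_one] at h1
  have h2 := Real.add_one_le_exp (t ^ 2 * v * (1 + B) / 2)
  have h3 : t * ∫ ω, V ω ∂μ ≤ 0 := mul_nonpos_of_nonneg_of_nonpos ht hmean
  have h4 : (t ^ 2 * (1 + B) / 2) * ∫ ω, V ω ^ 2 ∂μ ≤ (t ^ 2 * (1 + B) / 2) * v := by gcongr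
  linarith

theorem measureReal_sum_ge_le_exp {Ω : Type*} [MeasurableSpace Ω] {μ : Measure Ω}
    [IsProbabilityMeasure μ] {V : ℕ → Ω → ℝ} (hind : iIndepFun V μ) (hm : ∀ k, Measurable (V k))
    (hV : ∀ k, MemLp (V k) 2 μ) {v B t : ℝ} (hB : 0 ≤ B) (hB1 : B ≤ 1) (ht : 0 ≤ t)
    (hle : ∀ k ω, t * V k ω ≤ B) (hmean : ∀ k, ∫ ω, V k ω ∂μ ≤ 0)
    (hsq : ∀ k, ∫ ω, V k ω ^ 2 ∂μ ≤ v) (I : Finset ℕ) (x : ℝ) :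
    μ.real {ω | x ≤ ∑ k ∈ I, V k ω} ≤ Real.exp (-t * x + I.card * v * t ^ 2 * (1 + B) / 2) := by
  have hint : ∀ k, Integrable (fun ω => Real.exp (t * V k ω)) μ := fun k => by
    refine Integrable.of_bound (C := Real.exp B) (by have := hm k; fun_prop) (ae_of_all _ fun ω => ?_)
    rw [Real.norm_eq_abs, Real.abs_exp]
    exact Real.exp_le_exp.2 (hle k ω)
  have h1 := measure_ge_le_exp_mul_mgf (μ := μ) (X := ∑ k ∈ I, V k) x ht
    (hind.integrable_exp_mul_sum hm (s := I) fun k _ => hint k)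
  simp only [Finset.sum_apply] at h1
  refine h1.trans ?_
  rw [hind.mgf_sum hm, Real.exp_add]
  gcongr
  calc ∏ k ∈ I, mgf (V k) μ t ≤ ∏ k ∈ I, Real.exp (t ^ 2 * v * (1 + B) / 2) :=
        Finset.prod_le_prod (fun _ _ => mgf_nonneg)
          fun k _ => mgf_le_exp_of_le (hV k) hB hB1 ht (hle k) (hmean k) (hsq k)
    _ = _ := by
        rw [Finset.prod_const, ← Real.exp_nat_mul]; congr 1; ring

/-- The normalisation `√(n log n)` of moderate deviations. -/
noncomputable def sqrtMulLog (n : ℕ) : ℝ := Real.sqrt (n * Real.log n)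

/-- The Chernoff parameter is of order `√(log n / n)` and the truncation level is `n ^ s`; their
product plays the role of `B` above and must vanish. -/
theorem tendsto_sqrt_log_div_mul_rpow {s : ℝ} (hs : s < 1 / 2) :
    Tendsto (fun n : ℕ => Real.sqrt (Real.log n / n) * (n : ℝ) ^ s) atTop (𝓝 0) := by
  have h1 : Tendsto (fun x : ℝ => Real.log x / x ^ (1 - 2 * s)) atTop (𝓝 0) :=
    (isLittleO_log_rpow_atTop (by linarith)).tendsto_div_nhds_zero
  have h2 := (Real.continuous_sqrt.tendsto 0).comp (h1.comp tendsto_natCast_atTop_atTop)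
  rw [Real.sqrt_zero] at h2
  refine h2.congr' ?_
  filter_upwards [eventually_ge_atTop 1] with n hn
  have hn0 : (0 : ℝ) < n := by exact_mod_cast hn
  have hl : 0 ≤ Real.log n := Real.log_nonneg (by exact_mod_cast hn)
  simp only [Function.comp]
  have : (n : ℝ) ^ s = Real.sqrt ((n : ℝ) ^ (2 * s)) := by
    rw [Real.sqrt_eq_rpow, ← Real.rpow_mul hn0.le]; congr 1; ring
  rw [this, ← Real.sqrt_mul (by positivity)]
  congr 1
  rw [Real.rpow_sub hn0, Real.rpow_one]
  field_simp

/-- Upper moderate deviation bound for sums of truncated variables. -/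
theorem eventually_measureReal_sum_ge_le {Ω : Type*} [MeasurableSpace Ω] (μ : Measure Ω)
    [IsProbabilityMeasure μ] {w y s C δ : ℝ} (hw : 0 < w) (hy : 0 < y) (hs : s < 1 / 2)
    (hC : 0 ≤ C) (hδ : 0 < δ) :
    ∀ᶠ n : ℕ in atTop, ∀ (V : ℕ → Ω → ℝ) (I : Finset ℕ) (v : ℝ), iIndepFun V μ →
      (∀ k, Measurable (V k)) → (∀ k, MemLp (V k) 2 μ) → (∀ k ω, V k ω ≤ C * (n : ℝ) ^ s) →
      (∀ k, ∫ ω, V k ω ∂μ ≤ 0) → (∀ k, ∫ ω, V k ω ^ 2 ∂μ ≤ v) → I.card * v ≤ n * w →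
      μ.real {ω | y * sqrtMulLog n ≤ ∑ k ∈ I, V k ω} ≤
        (n : ℝ) ^ (-((1 - δ) * y ^ 2 / (2 * w))) := by
  have h0 : Tendsto (fun n : ℕ => y / w * C * (Real.sqrt (Real.log n / n) * (n : ℝ) ^ s))
      atTop (𝓝 0) := by simpa using (tendsto_sqrt_log_div_mul_rpow hs).const_mul (y / w * C)
  filter_upwards [h0.eventually_le_const (lt_min hδ one_pos), eventually_ge_atTop 2]
    with n hn hn2 V I v hind hm hV hle hmean hsq hcard
  have hn0 : (0 : ℝ) < n := by exact_mod_cast (by omega : 0 < n)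
  have hl : 0 ≤ Real.log n := Real.log_nonneg (by exact_mod_cast (by omega : 1 ≤ n))
  -- The parameter `t = (y / w) r` minimises `-t x + n w t² / 2` at `x = y √(n log n)`.
  set r := Real.sqrt (Real.log n / n) with hr
  have hr2 : r ^ 2 = Real.log n / n := Real.sq_sqrt (by positivity)
  have hr0 : 0 ≤ r := Real.sqrt_nonneg _
  have hrD : r * sqrtMulLog n = Real.log n := by
    rw [hr, sqrtMulLog, ← Real.sqrt_mul (by positivity)]
    rw [show Real.log n / n * (n * Real.log n) = Real.log n ^ 2 by field_simp, Real.sqrt_sq hl]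
  have hns : 0 ≤ (n : ℝ) ^ s := by positivity
  have key := measureReal_sum_ge_le_exp hind hm hV (v := v)
    (B := y / w * C * (r * (n : ℝ) ^ s)) (t := y / w * r)
    (by positivity) (hn.trans (min_le_right _ _)) (by positivity)
    (fun k ω => by
      calc y / w * r * V k ω ≤ y / w * r * (C * (n : ℝ) ^ s) :=
            mul_le_mul_of_nonneg_left (hle k ω) (by positivity)
        _ = _ := by ring) hmean hsq I (y * sqrtMulLog n)
  refine key.trans ?_
  rw [Real.rpow_def_of_pos hn0 (-((1 - δ) * y ^ 2 / (2 * w)))]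
  refine Real.exp_le_exp.2 ?_
  have hB := hn.trans (min_le_left _ _)
  have e1 : -(y / w * r) * (y * sqrtMulLog n) = -(y ^ 2 / w * Real.log n) := by
    rw [← hrD]; ring
  have e2 : I.card * v * (y / w * r) ^ 2 * (1 + y / w * C * (r * (n : ℝ) ^ s)) / 2
      ≤ n * w * (y / w * r) ^ 2 * (1 + δ) / 2 := by
    gcongr
  have e3 : n * w * (y / w * r) ^ 2 * (1 + δ) / 2 = y ^ 2 / w * Real.log n * (1 + δ) / 2 := by
    rw [mul_pow, hr2]; field_simp
  have e4 : Real.log n * -((1 - δ) * y ^ 2 / (2 * w)) =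
    -(y ^ 2 / w * Real.log n) + y ^ 2 / w * Real.log n * (1 + δ) / 2 := by field_simp; ring
  rw [e1, e4]
  linarith

/-! ### Lower moderate deviations from the central limit theorem. -/

/-- Consecutive blocks are independent, the second is distributed like an initial block of its
length, and if both are large then so is the total. -/
theorem measureReal_sum_add_ge {Ω : Type*} [MeasurableSpace Ω] {μ : Measure Ω}
    [IsProbabilityMeasure μ] {Y : ℕ → Ω → ℝ} (hind : iIndepFun Y μ) (hm : ∀ k, Measurable (Y k))
    (hid : ∀ k, IdentDistrib (Y k) (Y 0) μ μ) (j b : ℕ) (x u : ℝ) :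
    μ.real {ω | x ≤ ∑ k ∈ Finset.range j, Y k ω} * μ.real {ω | u ≤ ∑ k ∈ Finset.range b, Y k ω} ≤
      μ.real {ω | x + u ≤ ∑ k ∈ Finset.range (j + b), Y k ω} := by
  have hi : IndepFun (fun ω => ∑ k ∈ Finset.range j, Y k ω)
      (fun ω => ∑ k ∈ Finset.Ico j (j + b), Y k ω) μ := by
    have h := hind.indepFun_finset (Finset.range j) (Finset.Ico j (j + b))
      (by rw [Finset.range_eq_Ico]; exact Finset.Ico_disjoint_Ico_consecutive 0 j (j + b)) hm
    have h' := h.comp (φ := fun z : (Finset.range j → ℝ) => ∑ k, z k)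
      (ψ := fun z : (Finset.Ico j (j + b) → ℝ) => ∑ k, z k) (by fun_prop) (by fun_prop)
    convert h' using 1
    · ext ω; simp only [Function.comp]; exact (Finset.sum_coe_sort _ (fun k => Y k ω)).symm
    · ext ω; simp only [Function.comp]; exact (Finset.sum_coe_sort _ (fun k => Y k ω)).symm
  have hd : IdentDistrib (fun ω => ∑ k ∈ Finset.Ico j (j + b), Y k ω)
      (fun ω => ∑ k ∈ Finset.range b, Y k ω) μ μ := by
    have h := IdentDistrib.pi (X := fun k => Y (j + k)) (Y := Y) (μ := μ) (ν := μ)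
      (fun k => (hid _).trans (hid k).symm) (hind.precomp (add_right_injective j)) hind
    have h' := h.comp (u := fun z : ℕ → ℝ => ∑ k ∈ Finset.range b, z k) (by fun_prop)
    convert h' using 1
    · ext ω
      rw [Finset.sum_Ico_eq_sum_range]
      simp [Function.comp]
    · rfl
  have hms : ∀ I : Finset ℕ, Measurable fun ω => ∑ k ∈ I, Y k ω := fun I =>
    Finset.measurable_sum _ fun k _ => hm k
  have h1 : μ.real {ω | u ≤ ∑ k ∈ Finset.range b, Y k ω} =
      μ.real {ω | u ≤ ∑ k ∈ Finset.Ico j (j + b), Y k ω} :=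
    congrArg ENNReal.toReal (hd.measure_mem_eq (s := Set.Ici u) measurableSet_Ici).symm
  rw [h1]
  have h2 := hi.measure_inter_preimage_eq_mul (Set.Ici x) (Set.Ici u) measurableSet_Ici
    measurableSet_Ici
  have h3 := congrArg ENNReal.toReal h2
  rw [ENNReal.toReal_mul] at h3
  refine h3.ge.trans (measureReal_mono ?_)
  rintro ω ⟨h4, h5⟩
  simp only [Set.mem_preimage, Set.mem_Ici] at h4 h5
  simp only [Set.mem_ofPred_eq]
  rw [← Finset.sum_range_add_sum_Ico _ (Nat.le_add_right j b)]
  exact add_le_add h4 h5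

theorem measureReal_sum_mul_ge {Ω : Type*} [MeasurableSpace Ω] {μ : Measure Ω}
    [IsProbabilityMeasure μ] {Y : ℕ → Ω → ℝ} (hind : iIndepFun Y μ) (hm : ∀ k, Measurable (Y k))
    (hid : ∀ k, IdentDistrib (Y k) (Y 0) μ μ) (b : ℕ) (u : ℝ) (l : ℕ) :
    μ.real {ω | u ≤ ∑ k ∈ Finset.range b, Y k ω} ^ l ≤
      μ.real {ω | l * u ≤ ∑ k ∈ Finset.range (l * b), Y k ω} := by
  induction l with
  | zero => simp
  | succ l ih =>
    have h := measureReal_sum_add_ge hind hm hid (l * b) b (l * u) u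
    rw [pow_succ]
    refine (mul_le_mul_of_nonneg_right ih measureReal_nonneg).trans (h.trans_eq ?_)
    congr 1
    ext ω
    simp only [Set.mem_ofPred_eq]
    push_cast
    rw [add_one_mul, add_one_mul]

/-- The density on `(t, t + 1]` is at least its value at `t + 1`. The loss is harmless because `t`
is later taken large. -/
theorem gaussianReal_Ioi_ge {v : ℝ} (hv : 0 < v) {t : ℝ} (ht : 0 ≤ t) :
    (Real.sqrt (2 * Real.pi * v))⁻¹ * Real.exp (-(t + 1) ^ 2 / (2 * v)) ≤
      (gaussianReal 0 v.toNNReal).real (Set.Ioi t) := by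
  have hv' : v.toNNReal ≠ 0 := by simpa using hv
  set c := (Real.sqrt (2 * Real.pi * v))⁻¹ * Real.exp (-(t + 1) ^ 2 / (2 * v)) with hc
  have h : ENNReal.ofReal c ≤ gaussianReal 0 v.toNNReal (Set.Ioi t) := by
    rw [gaussianReal_apply _ hv']
    calc ENNReal.ofReal c = ∫⁻ x in Set.Ioc t (t + 1), ENNReal.ofReal c := by simp
      _ ≤ ∫⁻ x in Set.Ioc t (t + 1), gaussianPDF 0 v.toNNReal x := by
          refine setLIntegral_mono (by fun_prop) fun x hx => ?_
          rw [gaussianPDF, gaussianPDFReal]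
          refine ENNReal.ofReal_le_ofReal ?_
          rw [Real.coe_toNNReal _ hv.le, hc, sub_zero]
          have : x ≤ t + 1 := hx.2
          have : 0 ≤ x := ht.trans hx.1.le
          gcongr
      _ ≤ _ := lintegral_mono_set Set.Ioc_subset_Ioi_self
  rw [Measure.real, ← ENNReal.toReal_ofReal (r := c) (by positivity)]
  exact ENNReal.toReal_mono (measure_ne_top _ _) h

/-- The constant `c` does not depend on `t`: the block argument takes `t = y' K` and divides the
exponent by `K²`, which removes `c` as `K` grows. -/
theorem exists_eventually_exp_le_measureReal {Ω : Type*} [MeasurableSpace Ω] {μ : Measure Ω}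
    [IsProbabilityMeasure μ] {Y : ℕ → Ω → ℝ} (hind : iIndepFun Y μ)
    (hid : ∀ k, IdentDistrib (Y k) (Y 0) μ μ) (hY : MemLp (Y 0) 2 μ) {v m : ℝ}
    (hv : variance (Y 0) μ = v) (hv0 : 0 < v) (hmean : ∫ ω, Y 0 ω ∂μ = m) :
    ∃ c : ℝ, 0 ≤ c ∧ ∀ t : ℝ, 0 ≤ t → ∀ᶠ b : ℕ in atTop,
      Real.exp (-((t + 1) ^ 2 / (2 * v) + c)) ≤
        μ.real {ω | t * Real.sqrt b + b * m ≤ ∑ k ∈ Finset.range b, Y k ω} := by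
  set a := (Real.sqrt (2 * Real.pi * v))⁻¹ with ha
  have ha0 : 0 < a := by positivity
  -- Halving the Gaussian bound gives the strict inequality needed to pass from the liminf to all
  -- large `b`.
  refine ⟨|Real.log (a / 2)|, abs_nonneg _, fun t ht => ?_⟩
  have hclt := tendstoInDistribution_inv_sqrt_mul_sum_sub (P := μ) (X := Y)
    (Y := (id : ℝ → ℝ)) (P' := gaussianReal 0 (variance (Y 0) μ).toNNReal) ⟨by fun_prop, by simp⟩
    hY hind hid
  have hlim := ProbabilityMeasure.le_liminf_measure_open_of_tendsto hclt.tendsto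
    (isOpen_Ioi (a := t))
  have hg := gaussianReal_Ioi_ge hv0 ht
  rw [← ha] at hg
  have hpos : 0 < a / 2 * Real.exp (-(t + 1) ^ 2 / (2 * v)) := by positivity
  have hlt : ENNReal.ofReal (a / 2 * Real.exp (-(t + 1) ^ 2 / (2 * v))) <
      gaussianReal 0 (variance (Y 0) μ).toNNReal (Set.Ioi t) := by
    rw [hv]
    refine (ENNReal.ofReal_lt_iff_lt_toReal hpos.le (measure_ne_top _ _)).2 (lt_of_lt_of_le ?_ hg)
    have := hpos
    nlinarith
  have hlt' := lt_of_lt_of_le hlt (le_trans (by simp) hlim)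
  filter_upwards [eventually_lt_of_lt_liminf hlt', eventually_ge_atTop 1] with b hb hb1
  have hb0 : (0 : ℝ) < b := by exact_mod_cast hb1
  have hsb : 0 < Real.sqrt b := Real.sqrt_pos.2 hb0
  simp only [ProbabilityMeasure.coe_mk] at hb
  rw [Measure.map_apply_of_aemeasurable (hclt.forall_aemeasurable b) measurableSet_Ioi] at hb
  have hsub : (fun ω => (Real.sqrt b)⁻¹ * (∑ k ∈ Finset.range b, Y k ω - b * ∫ ω, Y 0 ω ∂μ)) ⁻¹'
      Set.Ioi t ⊆ {ω | t * Real.sqrt b + b * m ≤ ∑ k ∈ Finset.range b, Y k ω} := by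
    intro ω hω
    simp only [Set.mem_preimage, Set.mem_Ioi, hmean] at hω
    rw [inv_mul_eq_div, lt_div_iff₀ hsb] at hω
    simp only [Set.mem_ofPred_eq]
    linarith
  have h1 := hb.trans_le (measure_mono hsub)
  have h2 := ((ENNReal.ofReal_lt_iff_lt_toReal hpos.le (measure_ne_top _ _)).1 h1).le
  refine le_trans ?_ h2
  rw [neg_add, Real.exp_add, mul_comm, neg_div]
  gcongr
  calc Real.exp (-|Real.log (a / 2)|) ≤ Real.exp (Real.log (a / 2)) :=
        Real.exp_le_exp.2 (neg_abs_le _)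
    _ = a / 2 := Real.exp_log (by positivity)

/-- Cutting `n` into about `κ log n` blocks leaves block lengths tending to infinity, as the central
limit theorem requires. -/
theorem eventually_mul_ceil_log_le {κ : ℝ} (hκ : 0 ≤ κ) (B : ℕ) :
    ∀ᶠ n : ℕ in atTop, B * ⌈Real.log n * κ⌉₊ ≤ n := by
  have h1 : Tendsto (fun n : ℕ => (B * κ) * (Real.log n / n) + B * (n : ℝ)⁻¹) atTop (𝓝 0) := by
    have a1 := Real.isLittleO_log_id_atTop.tendsto_div_nhds_zero.comp
      (tendsto_natCast_atTop_atTop (R := ℝ))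
    have a2 := (tendsto_inv_atTop_zero (𝕜 := ℝ)).comp tendsto_natCast_atTop_atTop
    simpa using (a1.const_mul (B * κ)).add (a2.const_mul (B : ℝ))
  filter_upwards [h1.eventually_le_const one_pos, eventually_ge_atTop 1] with n hn hn1
  have hn0 : (0 : ℝ) < n := by exact_mod_cast hn1
  have hl : 0 ≤ Real.log n := Real.log_nonneg (by exact_mod_cast hn1)
  have h2 := (Nat.ceil_lt_add_one (mul_nonneg hl hκ)).le
  have h3 : (B : ℝ) * ⌈Real.log n * κ⌉₊ ≤ n := by
    calc (B : ℝ) * ⌈Real.log n * κ⌉₊ ≤ B * (Real.log n * κ + 1) := by gcongr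
      _ = ((B * κ) * (Real.log n / n) + B * (n : ℝ)⁻¹) * n := by field_simp
      _ ≤ 1 * n := by gcongr
      _ = n := one_mul _
  exact_mod_cast h3

/-- Lower moderate deviation bound for sums of nonnegative i.i.d. variables. -/
theorem eventually_rpow_le_measureReal_sum {Ω : Type*} [MeasurableSpace Ω] {μ : Measure Ω}
    [IsProbabilityMeasure μ] {Y : ℕ → Ω → ℝ} (hind : iIndepFun Y μ) (hm : ∀ k, Measurable (Y k))
    (hid : ∀ k, IdentDistrib (Y k) (Y 0) μ μ) (hY : MemLp (Y 0) 2 μ)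
    (hnonneg : ∀ k ω, 0 ≤ Y k ω) {v m y α : ℝ}
    (hv : variance (Y 0) μ = v) (hv0 : 0 < v) (hmean : ∫ ω, Y 0 ω ∂μ = m) (hy : 0 < y)
    (hα : y ^ 2 / (2 * v) < α) :
    ∀ᶠ n : ℕ in atTop, (n : ℝ) ^ (-α) ≤
      μ.real {ω | y * sqrtMulLog n + n * m ≤ ∑ k ∈ Finset.range n, Y k ω} := by
  -- Take `l ≈ log n / K²` blocks of length `b ≈ K² n / log n`. If each exceeds its mean by `y' K
  -- √b`, the total excess is about `y' √(n log n)`. This costs `exp (-h l) ≈ n ^ (-h / K²)`, and `h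
  -- / K²` tends to `y'² / (2 v)`. The gap `y' - y` pays for rounding `l` and `b`.
  obtain ⟨c, hc, H⟩ := exists_eventually_exp_le_measureReal hind hid hY hv hv0 hmean
  have hm0 : 0 ≤ m := hmean ▸ integral_nonneg (hnonneg 0)
  obtain ⟨y', hyy', hy'⟩ : ∃ y', y < y' ∧ y' ^ 2 / (2 * v) < α := by
    rw [div_lt_iff₀ (by positivity)] at hα
    obtain ⟨y', h1, h2⟩ := exists_between ((Real.lt_sqrt hy.le).2 hα)
    refine ⟨y', h1, ?_⟩
    rw [div_lt_iff₀ (by positivity)]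
    exact (Real.lt_sqrt (hy.trans h1).le).1 h2
  obtain ⟨K, hK1, hK⟩ : ∃ K : ℝ, 1 ≤ K ∧ ((y' * K + 1) ^ 2 / (2 * v) + c) * (K ^ 2)⁻¹ < α := by
    have h1 : Tendsto (fun K : ℝ => (y' + K⁻¹) ^ 2 / (2 * v) + c * K⁻¹ ^ 2) atTop
        (𝓝 ((y' + 0) ^ 2 / (2 * v) + c * 0 ^ 2)) :=
      (((tendsto_inv_atTop_zero.const_add y').pow 2).div_const _).add
        ((tendsto_inv_atTop_zero.pow 2).const_mul c)
    have h2 := (h1.eventually_lt_const (u := α) (by simpa using hy')).and (eventually_ge_atTop 1)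
    obtain ⟨K, h3, h4⟩ := h2.exists
    refine ⟨K, h4, lt_of_eq_of_lt ?_ h3⟩
    have : K ≠ 0 := by positivity
    field_simp
  have hK0 : 0 < K := by positivity
  have hy'0 : 0 < y' := hy.trans hyy'
  set h := (y' * K + 1) ^ 2 / (2 * v) + c with hh
  have hb : Tendsto (fun n : ℕ => n / ⌈Real.log n * (K ^ 2)⁻¹⌉₊) atTop atTop := by
    refine tendsto_atTop.2 fun B => ?_
    filter_upwards [eventually_mul_ceil_log_le (κ := (K ^ 2)⁻¹) (by positivity) B,
      eventually_ge_atTop 2] with n hn hn2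
    have hl : 0 < Real.log n := Real.log_pos (by exact_mod_cast hn2)
    exact (Nat.le_div_iff_mul_le (Nat.ceil_pos.2 (by positivity))).2 hn
  have hsq : Tendsto (fun b : ℕ => (y' - y) * K * Real.sqrt b) atTop atTop :=
    ((Real.tendsto_sqrt_atTop.comp tendsto_natCast_atTop_atTop)).const_mul_atTop
      (mul_pos (sub_pos.2 hyy') hK0)
  have hlog : Tendsto (fun n : ℕ => (α - h * (K ^ 2)⁻¹) * Real.log n) atTop atTop :=
    (Real.tendsto_log_atTop.comp tendsto_natCast_atTop_atTop).const_mul_atTop (sub_pos.2 hK)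
  filter_upwards [hb.eventually (H (y' * K) (by positivity)),
    hb.eventually (hsq.eventually_ge_atTop (y * K + m)), hlog.eventually_ge_atTop h,
    eventually_ge_atTop 2] with n h1 h2 h3 hn2
  have hl : 0 < Real.log n := Real.log_pos (by exact_mod_cast hn2)
  have hn0 : (0 : ℝ) < n := by exact_mod_cast (by omega : 0 < n)
  set l := ⌈Real.log n * (K ^ 2)⁻¹⌉₊ with hldef
  set b := n / l with hbdef
  have hl0 : 0 < l := Nat.ceil_pos.2 (by positivity)
  have hle : Real.log n * (K ^ 2)⁻¹ ≤ l := Nat.le_ceil _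
  have hlt : (l : ℝ) ≤ Real.log n * (K ^ 2)⁻¹ + 1 := (Nat.ceil_lt_add_one (by positivity)).le
  have hlb : l * b ≤ n := Nat.mul_div_le n l
  have hnl : (n : ℝ) ≤ l * (b + 1) := by exact_mod_cast (Nat.lt_mul_div_succ n hl0).le
  have hlogl : Real.log n ≤ K ^ 2 * l := by
    rw [← div_eq_mul_inv, div_le_iff₀ (by positivity)] at hle; linarith
  have hD : sqrtMulLog n ≤ K * l * (Real.sqrt b + 1) := by
    rw [sqrtMulLog]
    refine Real.sqrt_le_iff.2 ⟨by positivity, ?_⟩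
    calc n * Real.log n ≤ (l * (b + 1)) * (K ^ 2 * l) := by gcongr
      _ = K ^ 2 * l ^ 2 * (b + 1) := by ring
      _ ≤ K ^ 2 * l ^ 2 * (Real.sqrt b + 1) ^ 2 := by
          gcongr
          nlinarith [Real.sq_sqrt (Nat.cast_nonneg (α := ℝ) b), Real.sqrt_nonneg (b : ℝ)]
      _ = _ := by ring
  calc (n : ℝ) ^ (-α) ≤ Real.exp (-h) ^ l := by
        rw [← Real.exp_nat_mul, Real.rpow_def_of_pos hn0]
        refine Real.exp_le_exp.2 ?_
        have : h * l ≤ h * (Real.log n * (K ^ 2)⁻¹ + 1) := by gcongr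
        linarith
    _ ≤ μ.real {ω | y' * K * Real.sqrt b + b * m ≤ ∑ k ∈ Finset.range b, Y k ω} ^ l := by gcongr
    _ ≤ _ := measureReal_sum_mul_ge hind hm hid b _ l
    _ ≤ _ := by
        refine measureReal_mono fun ω hω => ?_
        simp only [Set.mem_ofPred_eq] at hω ⊢
        -- The fewer than `l` terms left over by the division are dropped because they are
        -- nonnegative.
        have hsum : ∑ k ∈ Finset.range (l * b), Y k ω ≤ ∑ k ∈ Finset.range n, Y k ω :=
          Finset.sum_le_sum_of_subset_of_nonneg (Finset.range_mono hlb) fun k _ _ => hnonneg k ω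
        refine le_trans ?_ (hω.trans hsum)
        calc y * sqrtMulLog n + n * m ≤ y * (K * l * (Real.sqrt b + 1)) + (l * (b + 1)) * m := by
              gcongr
          _ = l * (y * K * Real.sqrt b + (y * K + m) + b * m) := by ring
          _ ≤ l * (y * K * Real.sqrt b + (y' - y) * K * Real.sqrt b + b * m) := by gcongr
          _ = _ := by ring

/-! ### I.i.d. arrays and the laws of powers of distances. -/

/-- An infinite array of independent identically distributed real random variables. -/
structure IsIIDArray {Ω : Type*} [MeasurableSpace Ω] (X : ℕ → ℕ → Ω → ℝ) (μ : Measure Ω) :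
    Prop where
  measurable : ∀ i k, Measurable (X i k)
  indep : iIndepFun (fun ik : ℕ × ℕ => X ik.1 ik.2) μ
  ident : ∀ i k, IdentDistrib (X i k) (X 0 0) μ μ

/-- The `k`-th term `|X i k - X j k| ^ q` of the `q`-th power of the `l^q` distance between the
rows `i` and `j`. -/
noncomputable def distPow {Ω : Type*} (q : ℝ) (X : ℕ → ℕ → Ω → ℝ) (i j k : ℕ) (ω : Ω) : ℝ :=
  |X i k ω - X j k ω| ^ q

theorem distPow_nonneg {Ω : Type*} (q : ℝ) (X : ℕ → ℕ → Ω → ℝ) (i j k : ℕ) (ω : Ω) :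
    0 ≤ distPow q X i j k ω := Real.rpow_nonneg (abs_nonneg _) _

/-- Independence means that the joint law is a product measure, and a product over `ι × κ` curries
to a product over `ι` of products over `κ`. -/
theorem iIndepFun_curry {Ω ι κ : Type*} [MeasurableSpace Ω] {μ : Measure Ω}
    [IsProbabilityMeasure μ] {X : ι → κ → Ω → ℝ} (hm : ∀ i k, Measurable (X i k))
    (h : iIndepFun (fun ik : ι × κ => X ik.1 ik.2) μ) :
    iIndepFun (fun i ω k => X i k ω) μ := by
  have hp : ∀ i k, IsProbabilityMeasure (μ.map (X i k)) := fun i k =>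
    Measure.isProbabilityMeasure_map (hm i k).aemeasurable
  have hrow : ∀ i, iIndepFun (X i) μ := fun i =>
    h.precomp (g := fun k => (i, k)) (Prod.mk_right_injective i)
  rw [iIndepFun_iff_map_fun_eq_infinitePi_map (fun i => measurable_pi_lambda _ fun k => hm i k)]
  have h1 := (iIndepFun_iff_map_fun_eq_infinitePi_map (fun ik : ι × κ => hm ik.1 ik.2)).1 h
  have h2 := congrArg (Measure.map (MeasurableEquiv.curry ι κ ℝ)) h1
  rw [Measure.infinitePi_map_curry (fun i k => μ.map (X i k)),
    Measure.map_map (by fun_prop) (measurable_pi_lambda _ fun ik : ι × κ => hm ik.1 ik.2)] at h2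
  refine h2.trans ?_
  congr 1
  ext1 i
  exact ((iIndepFun_iff_map_fun_eq_infinitePi_map (hm i)).1 (hrow i)).symm

namespace IsIIDArray

set_option linter.unusedSectionVars false

variable {Ω : Type*} [MeasurableSpace Ω] {μ : Measure Ω} [IsProbabilityMeasure μ]
  {X : ℕ → ℕ → Ω → ℝ}

theorem iIndepFun_rows (h : IsIIDArray X μ) : iIndepFun (fun i ω k => X i k ω) μ :=
  iIndepFun_curry h.measurable h.indep

theorem iIndepFun_columns (h : IsIIDArray X μ) : iIndepFun (fun k ω i => X i k ω) μ :=
  iIndepFun_curry (X := fun k i => X i k) (fun k i => h.measurable i k)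
    (h.indep.precomp (g := Prod.swap) Prod.swap_injective)

theorem measurable_row (h : IsIIDArray X μ) (i : ℕ) : Measurable fun ω k => X i k ω :=
  measurable_pi_lambda _ fun k => h.measurable i k

theorem identDistrib_comp (h : IsIIDArray X μ) {ι : Type*} [Countable ι] {e e' : ι → ℕ × ℕ}
    (he : e.Injective) (he' : e'.Injective) :
    IdentDistrib (fun ω l => X (e l).1 (e l).2 ω) (fun ω l => X (e' l).1 (e' l).2 ω) μ μ :=
  IdentDistrib.pi (X := fun l => X (e l).1 (e l).2) (Y := fun l => X (e' l).1 (e' l).2)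
    (fun _ => (h.ident _ _).trans (h.ident _ _).symm) (h.indep.precomp he) (h.indep.precomp he')

theorem identDistrib_rows (h : IsIIDArray X μ) {i j : ℕ} (hij : i ≠ j) :
    IdentDistrib (fun ω => ((fun k => X i k ω), (fun k => X j k ω)))
      (fun ω => ((fun k => X 0 k ω), (fun k => X 1 k ω))) μ μ := by
  have hrow : ∀ i i' : ℕ, IdentDistrib (fun ω k => X i k ω) (fun ω k => X i' k ω) μ μ :=
    fun i i' => h.identDistrib_comp (e := fun k => (i, k)) (e' := fun k => (i', k))
      (Prod.mk_right_injective i) (Prod.mk_right_injective i')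
  exact (hrow i 0).prodMk (hrow j 1) (h.iIndepFun_rows.indepFun hij)
    (h.iIndepFun_rows.indepFun zero_ne_one)

theorem measurable_distPow (h : IsIIDArray X μ) (q : ℝ) (i j k : ℕ) :
    Measurable (distPow q X i j k) := by
  have h1 := h.measurable i k
  have h2 := h.measurable j k
  unfold distPow
  fun_prop

theorem identDistrib_distPow_pair (h : IsIIDArray X μ) (q : ℝ) {a b c k : ℕ} (hab : a ≠ b)
    (hac : a ≠ c) (hbc : b ≠ c) :
    IdentDistrib (fun ω => (distPow q X a b k ω, distPow q X a c k ω))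
      (fun ω => (distPow q X 0 1 0 ω, distPow q X 0 2 0 ω)) μ μ := by
  have he : Function.Injective fun l : Fin 3 => ((![a, b, c] : Fin 3 → ℕ) l, k) := by
    intro x y hxy
    fin_cases x <;> fin_cases y <;> simp_all
  have he' : Function.Injective fun l : Fin 3 => ((![0, 1, 2] : Fin 3 → ℕ) l, 0) := by
    intro x y hxy
    fin_cases x <;> fin_cases y <;> simp_all
  exact (h.identDistrib_comp he he').comp
    (u := fun z : Fin 3 → ℝ => (|z 0 - z 1| ^ q, |z 0 - z 2| ^ q)) (by fun_prop)

theorem identDistrib_distPow (h : IsIIDArray X μ) (q : ℝ) {i j : ℕ} (hij : i ≠ j) (k : ℕ) :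
    IdentDistrib (distPow q X i j k) (distPow q X 0 1 0) μ μ := by
  have he : Function.Injective fun l : Fin 2 => ((![i, j] : Fin 2 → ℕ) l, k) := by
    intro x y hxy
    fin_cases x <;> fin_cases y <;> simp_all
  have he' : Function.Injective fun l : Fin 2 => ((![0, 1] : Fin 2 → ℕ) l, 0) := by
    intro x y hxy
    fin_cases x <;> fin_cases y <;> simp_all
  exact (h.identDistrib_comp he he').comp
    (u := fun z : Fin 2 → ℝ => |z 0 - z 1| ^ q) (by fun_prop)

theorem iIndepFun_distPow (h : IsIIDArray X μ) (q : ℝ) (i j : ℕ) :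
    iIndepFun (distPow q X i j) μ :=
  h.iIndepFun_columns.comp (fun _ z => |z i - z j| ^ q) fun _ => by fun_prop

theorem iIndepFun_distPow_pair (h : IsIIDArray X μ) (q : ℝ) (a b c : ℕ) :
    iIndepFun (fun k ω => (distPow q X a b k ω, distPow q X a c k ω)) μ :=
  h.iIndepFun_columns.comp (fun _ z => (|z a - z b| ^ q, |z a - z c| ^ q)) fun _ => by fun_prop

theorem memLp_distPow (h : IsIIDArray X μ) {q r : ℝ} (hq : 0 < q) (hr : 0 < r)
    (hX : Integrable (fun ω => |X 0 0 ω| ^ (q * r)) μ) :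
    MemLp (distPow q X 0 1 0) (ENNReal.ofReal r) μ := by
  have hqr : ENNReal.ofReal (q * r) ≠ 0 := by simp only [ne_eq, ENNReal.ofReal_eq_zero]; nlinarith [mul_pos hq hr]
  have h0 : MemLp (X 0 0) (ENNReal.ofReal (q * r)) μ := by
    rw [← memLp_norm_rpow_iff (h.measurable 0 0).aestronglyMeasurable hqr ENNReal.ofReal_ne_top,
      ENNReal.div_self hqr ENNReal.ofReal_ne_top, memLp_one_iff_integrable,
      ENNReal.toReal_ofReal (by positivity)]
    exact hX
  have h1 : MemLp (X 1 0) (ENNReal.ofReal (q * r)) μ := (h.ident 1 0).symm.memLp_snd h0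
  have h2 := (h0.sub h1).norm_rpow_div (ENNReal.ofReal q)
  rw [ENNReal.toReal_ofReal hq.le, ← ENNReal.ofReal_div_of_pos hq, mul_div_cancel_left₀ _ hq.ne']
    at h2
  exact h2

theorem memLp_distPow_of_ne (h : IsIIDArray X μ) {q : ℝ} {r : ENNReal}
    (hX : MemLp (distPow q X 0 1 0) r μ) {i j : ℕ} (hij : i ≠ j) (k : ℕ) :
    MemLp (distPow q X i j k) r μ := (h.identDistrib_distPow q hij k).symm.memLp_snd hX

/-- If the variance vanished, the three mutual distances of three entries would almost surely equal
one constant. Three points of the line at equal mutual distances coincide, so two independent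
entries would be almost surely equal, and their covariance, which is `0`, would be the positive
variance. -/
theorem variance_distPow_pos (h : IsIIDArray X μ) {q : ℝ} (hq : 0 < q)
    (hX : MemLp (distPow q X 0 1 0) 2 μ) (hvar : 0 < variance (X 0 0) μ) :
    0 < variance (distPow q X 0 1 0) μ := by
  refine lt_of_le_of_ne (variance_nonneg _ _) fun h0 => ?_
  have hc : ∀ i j, i ≠ j → ∀ᵐ ω ∂μ, distPow q X i j 0 ω = ∫ ω, distPow q X 0 1 0 ω ∂μ :=
    fun i j hij => by
    have hd := h.identDistrib_distPow q hij 0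
    have := ae_eq_integral_of_variance_eq_zero (hd.symm.memLp_snd hX) (hd.variance_eq.trans h0.symm)
    rwa [hd.integral_eq] at this
  have heq : X 1 0 =ᵐ[μ] X 0 0 := by
    filter_upwards [hc 0 1 (by decide), hc 0 2 (by decide), hc 1 2 (by decide)] with ω h1 h2 h3
    have e1 : |X 0 0 ω - X 1 0 ω| = |X 0 0 ω - X 2 0 ω| :=
      (Real.rpow_left_inj (abs_nonneg _) (abs_nonneg _) hq.ne').1 (h1.trans h2.symm)
    have e2 : |X 0 0 ω - X 1 0 ω| = |X 1 0 ω - X 2 0 ω| :=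
      (Real.rpow_left_inj (abs_nonneg _) (abs_nonneg _) hq.ne').1 (h1.trans h3.symm)
    rcases abs_eq_abs.1 e1 with a | a <;> rcases abs_eq_abs.1 e2 with b | b <;> linarith
  have hL : MemLp (X 0 0) 2 μ := memLp_two_of_variance_ne_zero
    (h.measurable 0 0).aestronglyMeasurable hvar.ne'
  have hind : IndepFun (X 0 0) (X 1 0) μ :=
    h.indep.indepFun (i := (0, 0)) (j := (1, 0)) (by simp)
  have hcov := hind.covariance_eq_zero hL ((h.ident 1 0).symm.memLp_snd hL)
  have hcov' : covariance (X 0 0) (X 1 0) μ = covariance (X 0 0) (X 0 0) μ := by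
    unfold covariance
    rw [integral_congr_ae heq]
    refine integral_congr_ae ?_
    filter_upwards [heq] with ω hω
    rw [hω]
  rw [hcov', covariance_self (h.measurable 0 0).aemeasurable] at hcov
  exact hvar.ne' hcov

theorem measureReal_lt_distPow_le (h : IsIIDArray X μ) {q r : ℝ} (hr : 0 < r)
    (hX : Integrable (fun ω => distPow q X 0 1 0 ω ^ r) μ) {t : ℝ} (ht : 0 < t)
    {i j : ℕ} (hij : i ≠ j) (k : ℕ) :
    μ.real {ω | t < distPow q X i j k ω} ≤ (∫ ω, distPow q X 0 1 0 ω ^ r ∂μ) * t ^ (-r) := by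
  have h0 : μ.real {ω | t < distPow q X i j k ω} = μ.real {ω | t < distPow q X 0 1 0 ω} :=
    congrArg ENNReal.toReal ((h.identDistrib_distPow q hij k).measure_mem_eq measurableSet_Ioi)
  have h1 := mul_meas_ge_le_integral_of_nonneg
    (ae_of_all μ fun ω => Real.rpow_nonneg (distPow_nonneg q X 0 1 0 ω) r) hX (t ^ r)
  have h2 : μ.real {ω | t < distPow q X 0 1 0 ω} ≤
      μ.real {ω | t ^ r ≤ distPow q X 0 1 0 ω ^ r} :=
    measureReal_mono fun ω hω => Real.rpow_le_rpow ht.le (le_of_lt hω) hr.le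
  rw [h0, Real.rpow_neg ht.le, ← div_eq_mul_inv, le_div_iff₀ (by positivity), mul_comm]
  exact (mul_le_mul_of_nonneg_left h2 (by positivity)).trans h1

end IsIIDArray

/-! ### Second moments under truncation. -/

section Truncation

variable {Ω : Type*} [MeasurableSpace Ω] {μ : Measure Ω} [IsProbabilityMeasure μ]

/-- The centre `m` is kept fixed under truncation. In the application it is the untruncated mean, so
the centred truncated variable has nonpositive mean, all that the Chernoff bound asks for. -/
theorem tendsto_integral_sq_min_sub {Y : Ω → ℝ} (hm : Measurable Y) (hY : MemLp Y 2 μ)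
    (h0 : ∀ ω, 0 ≤ Y ω) (m : ℝ) :
    Tendsto (fun M : ℝ => ∫ ω, (min (Y ω) M - m) ^ 2 ∂μ) atTop (𝓝 (∫ ω, (Y ω - m) ^ 2 ∂μ)) := by
  have hb : Integrable (fun ω => (Y ω + |m|) ^ 2) μ := (hY.add (memLp_const _)).integrable_sq
  refine tendsto_integral_filter_of_dominated_convergence _
    (Eventually.of_forall fun M => by fun_prop) ?_ hb (ae_of_all _ fun ω => ?_)
  · filter_upwards [eventually_ge_atTop 0] with M hM
    refine ae_of_all _ fun ω => ?_
    rw [Real.norm_eq_abs, abs_of_nonneg (sq_nonneg _)]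
    refine sq_le_sq' ?_ ?_
    · have : 0 ≤ min (Y ω) M := le_min (h0 ω) hM
      linarith [le_abs_self m, h0 ω]
    · linarith [neg_abs_le m, min_le_left (Y ω) M]
  · refine tendsto_const_nhds.congr' ?_
    filter_upwards [eventually_ge_atTop (Y ω)] with M hM
    rw [min_eq_left hM]

theorem tendsto_integral_sq_min_add_min_sub {Y Z : Ω → ℝ} (hmY : Measurable Y)
    (hmZ : Measurable Z) (hY : MemLp Y 2 μ) (hZ : MemLp Z 2 μ)
    (h0 : ∀ ω, 0 ≤ Y ω) (h0' : ∀ ω, 0 ≤ Z ω) (m : ℝ) :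
    Tendsto (fun M : ℝ => ∫ ω, (min (Y ω) M + min (Z ω) M - m) ^ 2 ∂μ) atTop
      (𝓝 (∫ ω, (Y ω + Z ω - m) ^ 2 ∂μ)) := by
  have hb : Integrable (fun ω => (Y ω + Z ω + |m|) ^ 2) μ :=
    ((hY.add hZ).add (memLp_const _)).integrable_sq
  refine tendsto_integral_filter_of_dominated_convergence _
    (Eventually.of_forall fun M => by fun_prop) ?_ hb (ae_of_all _ fun ω => ?_)
  · filter_upwards [eventually_ge_atTop 0] with M hM
    refine ae_of_all _ fun ω => ?_
    rw [Real.norm_eq_abs, abs_of_nonneg (sq_nonneg _)]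
    refine sq_le_sq' ?_ ?_
    · have : 0 ≤ min (Y ω) M := le_min (h0 ω) hM
      have : 0 ≤ min (Z ω) M := le_min (h0' ω) hM
      linarith [le_abs_self m, h0 ω, h0' ω]
    · linarith [neg_abs_le m, min_le_left (Y ω) M, min_le_left (Z ω) M]
  · refine tendsto_const_nhds.congr' ?_
    filter_upwards [eventually_ge_atTop (Y ω), eventually_ge_atTop (Z ω)] with M hM hM'
    rw [min_eq_left hM, min_eq_left hM']

theorem memLp_min_const {Y : Ω → ℝ} (hm : Measurable Y) (h0 : ∀ ω, 0 ≤ Y ω) {M : ℝ} (hM : 0 ≤ M)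
    (r : ENNReal) : MemLp (fun ω => min (Y ω) M) r μ := by
  refine MemLp.of_bound (by fun_prop) M (ae_of_all _ fun ω => ?_)
  rw [Real.norm_eq_abs, abs_of_nonneg (le_min (h0 ω) hM)]
  exact min_le_right _ _

end Truncation

/-! ### Polynomial bounds and Borel–Cantelli along geometric sequences. -/

theorem eventually_const_mul_rpow_le {a b : ℝ} (hab : a < b) (A : ℝ) :
    ∀ᶠ n : ℕ in atTop, A * (n : ℝ) ^ a ≤ (n : ℝ) ^ b := by
  have h := ((tendsto_rpow_atTop (sub_pos.2 hab)).comp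
    (tendsto_natCast_atTop_atTop (R := ℝ))).eventually_ge_atTop A
  filter_upwards [h, eventually_ge_atTop 1] with n hn hn1
  have hn0 : (0 : ℝ) < n := by exact_mod_cast hn1
  calc A * (n : ℝ) ^ a ≤ (n : ℝ) ^ (b - a) * (n : ℝ) ^ a := by gcongr; exact hn
    _ = (n : ℝ) ^ b := by rw [← Real.rpow_add hn0]; congr 1; ring

/-- Along `⌈ρ ^ k⌉` any polynomial decay becomes geometric, so every `η > 0` is summable. -/
theorem ae_eventually_notMem_of_measureReal_le_rpow {Ω : Type*} [MeasurableSpace Ω] {μ : Measure Ω}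
    [IsProbabilityMeasure μ] {E : ℕ → Set Ω} {A η ρ : ℝ} (hη : 0 < η) (hρ : 1 < ρ)
    (hE : ∀ᶠ N : ℕ in atTop, μ.real (E N) ≤ A * (N : ℝ) ^ (-η)) :
    ∀ᵐ ω ∂μ, ∀ᶠ k : ℕ in atTop, ω ∉ E ⌈ρ ^ k⌉₊ := by
  refine ae_eventually_notMem ?_
  have hρ0 : 0 < ρ := by linarith
  have htend : Tendsto (fun k : ℕ => ⌈ρ ^ k⌉₊) atTop atTop :=
    tendsto_nat_ceil_atTop.comp (tendsto_pow_atTop_atTop_of_one_lt hρ)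
  have hgeo : Summable fun k : ℕ => |A| * (ρ ^ (-η)) ^ k :=
    (summable_geometric_of_lt_one (by positivity)
      (Real.rpow_lt_one_of_one_lt_of_neg hρ (neg_lt_zero.2 hη))).mul_left _
  have hsum : Summable fun k : ℕ => μ.real (E ⌈ρ ^ k⌉₊) := by
    refine summable_of_isBigO_nat hgeo (Asymptotics.IsBigO.of_bound 1 ?_)
    filter_upwards [htend.eventually hE] with k hk
    rw [Real.norm_of_nonneg measureReal_nonneg, Real.norm_of_nonneg (by positivity), one_mul]
    refine hk.trans ?_
    have h1 : ((⌈ρ ^ k⌉₊ : ℕ) : ℝ) ^ (-η) ≤ (ρ ^ (-η)) ^ k := by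
      rw [← Real.rpow_natCast (ρ ^ (-η)), ← Real.rpow_mul hρ0.le, mul_comm, Real.rpow_mul hρ0.le,
        Real.rpow_natCast]
      exact Real.rpow_le_rpow_of_nonpos (by positivity) (Nat.le_ceil _) (by linarith)
    exact mul_le_mul (le_abs_self A) h1 (by positivity) (abs_nonneg A)
  have h2 := hsum.tsum_ofReal_ne_top
  simpa only [ofReal_measureReal (measure_ne_top μ _)] using h2

theorem eventually_measureReal_sum_ge_le_rpow {Ω : Type*} [MeasurableSpace Ω] (μ : Measure Ω)
    [IsProbabilityMeasure μ] {w y s C β : ℝ} (hw : 0 < w) (hy : 0 < y) (hs : s < 1 / 2)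
    (hC : 0 ≤ C) (hβ : β < y ^ 2 / (2 * w)) :
    ∀ᶠ n : ℕ in atTop, ∀ (V : ℕ → Ω → ℝ) (I : Finset ℕ) (v : ℝ), iIndepFun V μ →
      (∀ k, Measurable (V k)) → (∀ k, MemLp (V k) 2 μ) → (∀ k ω, V k ω ≤ C * (n : ℝ) ^ s) →
      (∀ k, ∫ ω, V k ω ∂μ ≤ 0) → (∀ k, ∫ ω, V k ω ^ 2 ∂μ ≤ v) → I.card * v ≤ n * w →
      μ.real {ω | y * sqrtMulLog n ≤ ∑ k ∈ I, V k ω} ≤ (n : ℝ) ^ (-β) := by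
  rw [lt_div_iff₀ (by positivity)] at hβ
  have hδ : 0 < 1 - β * (2 * w) / y ^ 2 := by
    rw [sub_pos, div_lt_one (by positivity)]
    exact hβ
  have h := eventually_measureReal_sum_ge_le μ hw hy hs hC hδ
  rwa [show (1 - (1 - β * (2 * w) / y ^ 2)) * y ^ 2 / (2 * w) = β by field_simp; ring] at h

/-! ### Tail bounds for sums of powers of distances. -/

namespace IsIIDArray

set_option linter.unusedSectionVars false

variable {Ω : Type*} [MeasurableSpace Ω] {μ : Measure Ω} [IsProbabilityMeasure μ]
  {X : ℕ → ℕ → Ω → ℝ}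

theorem integral_min_distPow_le (h : IsIIDArray X μ) {q : ℝ}
    (hX : MemLp (distPow q X 0 1 0) 2 μ) {M : ℝ} (hM : 0 ≤ M) :
    ∫ ω, min (distPow q X 0 1 0 ω) M ∂μ ≤ ∫ ω, distPow q X 0 1 0 ω ∂μ :=
  integral_mono ((memLp_min_const (h.measurable_distPow q 0 1 0) (distPow_nonneg q X 0 1 0) hM
    2).integrable (by norm_num)) (hX.integrable (by norm_num)) fun _ => min_le_left _ _

/-- Tail bound for sums of truncated centred powers of distances. -/
theorem eventually_measureReal_sum_min_le (h : IsIIDArray X μ) {q s y κ β v m : ℝ}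
    (hX : MemLp (distPow q X 0 1 0) 2 μ) (hm : ∫ ω, distPow q X 0 1 0 ω ∂μ = m)
    (hv : variance (distPow q X 0 1 0) μ = v) (hv0 : 0 < v) (hs0 : 0 < s) (hs : s < 1 / 2)
    (hy : 0 < y) (hκ : 0 < κ) (hβ0 : 0 < β) (hβ : β < y ^ 2 / (2 * (κ * v))) :
    ∀ᶠ N : ℕ in atTop, ∀ i j : ℕ, i ≠ j → ∀ I : Finset ℕ, (I.card : ℝ) ≤ κ * N →
      μ.real {ω | y * sqrtMulLog N ≤ ∑ k ∈ I, (min (distPow q X i j k ω) ((N : ℝ) ^ s) - m)} ≤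
        (N : ℝ) ^ (-β) := by
  have hm0 : 0 ≤ m := hm ▸ integral_nonneg (distPow_nonneg q X 0 1 0)
  -- The truncated second moment only converges to `v`; taking `w` slightly above `κ v` leaves room
  -- for this without losing `β`.
  obtain ⟨w, hw1, hw2⟩ : ∃ w, κ * v < w ∧ β < y ^ 2 / (2 * w) := by
    rw [lt_div_iff₀ (by positivity)] at hβ
    obtain ⟨w, h1, h2⟩ := exists_between (a₁ := κ * v) (a₂ := y ^ 2 / (2 * β))
      (by rw [lt_div_iff₀ (by positivity)]; linarith)
    have : 0 < w := (by positivity : 0 < κ * v).trans h1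
    refine ⟨w, h1, ?_⟩
    rw [lt_div_iff₀ (by positivity)] at h2 ⊢
    linarith
  have hw0 : 0 < w := (by positivity : 0 < κ * v).trans hw1
  have hlim := (tendsto_integral_sq_min_sub (h.measurable_distPow q 0 1 0) hX
    (distPow_nonneg q X 0 1 0) m).comp ((tendsto_rpow_atTop hs0).comp
      (tendsto_natCast_atTop_atTop (R := ℝ)))
  have hvw : ∫ ω, (distPow q X 0 1 0 ω - m) ^ 2 ∂μ < w / κ := by
    rw [← hm, ← variance_eq_integral (h.measurable_distPow q 0 1 0).aemeasurable, hv,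
      lt_div_iff₀ hκ]
    linarith
  filter_upwards [hlim.eventually_le_const hvw,
    eventually_measureReal_sum_ge_le_rpow μ hw0 hy hs zero_le_one hw2]
    with N hN htail i j hij I hI
  have hN0 : 0 ≤ (N : ℝ) ^ s := by positivity
  have hid : ∀ k, IdentDistrib (fun ω => min (distPow q X i j k ω) ((N : ℝ) ^ s) - m)
      (fun ω => min (distPow q X 0 1 0 ω) ((N : ℝ) ^ s) - m) μ μ := fun k =>
    (h.identDistrib_distPow q hij k).comp (u := fun x => min x ((N : ℝ) ^ s) - m) (by fun_prop)
  have hL := (memLp_min_const (μ := μ) (h.measurable_distPow q 0 1 0) (distPow_nonneg q X 0 1 0)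
    hN0 2)
  refine htail (fun k ω => min (distPow q X i j k ω) ((N : ℝ) ^ s) - m) I (w / κ)
    ((h.iIndepFun_distPow q i j).comp (fun _ x => min x ((N : ℝ) ^ s) - m) fun _ => by fun_prop)
    (fun k => ((h.measurable_distPow q i j k).min measurable_const).sub_const m)
    (fun k => (hid k).symm.memLp_snd (hL.sub (memLp_const m)))
    (fun k ω => by linarith [min_le_right (distPow q X i j k ω) ((N : ℝ) ^ s)])
    (fun k => ?_) (fun k => ?_) ?_
  · rw [(hid k).integral_eq, integral_sub (hL.integrable (by norm_num)) (integrable_const _)]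
    have := h.integral_min_distPow_le hX hN0
    simp only [integral_const, probReal_univ, smul_eq_mul, one_mul]
    linarith
  · exact (((hid k).comp (u := fun x => x ^ 2) (by fun_prop)).integral_eq).trans_le hN
  · calc (I.card : ℝ) * (w / κ) ≤ κ * N * (w / κ) := by gcongr
      _ = N * w := by field_simp

/-- Lower tail bound for sums of centred powers of distances. -/
theorem eventually_measureReal_sum_sub_le (h : IsIIDArray X μ) {q y κ β v m : ℝ}
    (hX : MemLp (distPow q X 0 1 0) 2 μ) (hm : ∫ ω, distPow q X 0 1 0 ω ∂μ = m)
    (hv : variance (distPow q X 0 1 0) μ = v) (hv0 : 0 < v)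
    (hy : 0 < y) (hκ : 0 < κ) (hβ : β < y ^ 2 / (2 * (κ * v))) :
    ∀ᶠ N : ℕ in atTop, ∀ i j : ℕ, i ≠ j → ∀ I : Finset ℕ, (I.card : ℝ) ≤ κ * N →
      μ.real {ω | y * sqrtMulLog N ≤ ∑ k ∈ I, (m - distPow q X i j k ω)} ≤ (N : ℝ) ^ (-β) := by
  have hm0 : 0 ≤ m := hm ▸ integral_nonneg (distPow_nonneg q X 0 1 0)
  -- The summands are at most `m`, so no truncation is needed and `s = 0` serves.
  filter_upwards [eventually_measureReal_sum_ge_le_rpow μ (s := 0) (by positivity : 0 < κ * v) hy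
    (by norm_num) hm0 hβ] with N htail i j hij I hI
  have hid : ∀ k, IdentDistrib (fun ω => m - distPow q X i j k ω)
      (fun ω => m - distPow q X 0 1 0 ω) μ μ := fun k =>
    (h.identDistrib_distPow q hij k).comp (u := fun x => m - x) (by fun_prop)
  refine htail (fun k ω => m - distPow q X i j k ω) I v
    ((h.iIndepFun_distPow q i j).comp (fun _ x => m - x) fun _ => by fun_prop)
    (fun k => (h.measurable_distPow q i j k).const_sub m)
    (fun k => (hid k).symm.memLp_snd ((memLp_const m).sub hX))
    (fun k ω => by simpa using distPow_nonneg q X i j k ω)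
    (fun k => ?_) (fun k => ?_) ?_
  · rw [(hid k).integral_eq, integral_sub (integrable_const _) (hX.integrable (by norm_num)), hm]
    simp
  · refine (((hid k).comp (u := fun x => x ^ 2) (by fun_prop)).integral_eq).trans_le ?_
    rw [← hv, variance_eq_integral (h.measurable_distPow q 0 1 0).aemeasurable, hm]
    refine (integral_congr_ae (ae_of_all _ fun ω => ?_)).le
    simp only [Function.comp]
    ring
  · calc (I.card : ℝ) * v ≤ κ * N * v := by gcongr
      _ = N * (κ * v) := by ring

/-- Joint tail bound for two sums of truncated centred powers of distances sharing one row. -/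
theorem eventually_measureReal_inter_le (h : IsIIDArray X μ) {q s y w β m : ℝ}
    (hX : MemLp (distPow q X 0 1 0) 2 μ) (hm : ∫ ω, distPow q X 0 1 0 ω ∂μ = m)
    (hw : 2 * variance (distPow q X 0 1 0) μ +
      2 * covariance (distPow q X 0 1 0) (distPow q X 0 2 0) μ < w) (hw0 : 0 < w)
    (hs0 : 0 < s) (hs : s < 1 / 2) (hy : 0 < y) (hβ : β < 2 * y ^ 2 / w) :
    ∀ᶠ N : ℕ in atTop, ∀ a b c : ℕ, a ≠ b → a ≠ c → b ≠ c →
      μ.real ({ω | y * sqrtMulLog N ≤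
          ∑ k ∈ Finset.range N, (min (distPow q X a b k ω) ((N : ℝ) ^ s) - m)} ∩
        {ω | y * sqrtMulLog N ≤
          ∑ k ∈ Finset.range N, (min (distPow q X a c k ω) ((N : ℝ) ^ s) - m)}) ≤
        (N : ℝ) ^ (-β) := by
  have hm0 : 0 ≤ m := hm ▸ integral_nonneg (distPow_nonneg q X 0 1 0)
  have hX2 : MemLp (distPow q X 0 2 0) 2 μ := h.memLp_distPow_of_ne hX (by decide) 0
  have hid2 := h.identDistrib_distPow q (i := 0) (j := 2) (by decide) 0
  have hlim := (tendsto_integral_sq_min_add_min_sub (h.measurable_distPow q 0 1 0)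
    (h.measurable_distPow q 0 2 0) hX hX2
    (distPow_nonneg q X 0 1 0) (distPow_nonneg q X 0 2 0) (2 * m)).comp ((tendsto_rpow_atTop hs0).comp
      (tendsto_natCast_atTop_atTop (R := ℝ)))
  have hvw : ∫ ω, (distPow q X 0 1 0 ω + distPow q X 0 2 0 ω - 2 * m) ^ 2 ∂μ < w := by
    have h1 := variance_fun_add hX hX2
    have hae : AEMeasurable (fun ω => distPow q X 0 1 0 ω + distPow q X 0 2 0 ω) μ :=
      (h.measurable_distPow q 0 1 0).aemeasurable.add (h.measurable_distPow q 0 2 0).aemeasurable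
    rw [variance_eq_integral hae, hid2.variance_eq,
      integral_add (hX.integrable (by norm_num)) (hX2.integrable (by norm_num)),
      hid2.integral_eq, hm] at h1
    rw [two_mul m, h1]
    linarith
  filter_upwards [hlim.eventually_le_const hvw,
    eventually_measureReal_sum_ge_le_rpow μ hw0 (y := 2 * y) (by positivity) hs zero_le_two
      (β := β) (by convert hβ using 1; field_simp)]
    with N hN htail a b c hab hac hbc
  have hN0 : 0 ≤ (N : ℝ) ^ s := by positivity
  have hid : ∀ k, IdentDistrib
      (fun ω => min (distPow q X a b k ω) ((N : ℝ) ^ s) + min (distPow q X a c k ω) ((N : ℝ) ^ s)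
        - 2 * m)
      (fun ω => min (distPow q X 0 1 0 ω) ((N : ℝ) ^ s) + min (distPow q X 0 2 0 ω) ((N : ℝ) ^ s)
        - 2 * m) μ μ := fun k =>
    (h.identDistrib_distPow_pair q hab hac hbc).comp
      (u := fun x : ℝ × ℝ => min x.1 ((N : ℝ) ^ s) + min x.2 ((N : ℝ) ^ s) - 2 * m) (by fun_prop)
  have hL := (memLp_min_const (μ := μ) (h.measurable_distPow q 0 1 0) (distPow_nonneg q X 0 1 0)
    hN0 2)
  have hL2 := (memLp_min_const (μ := μ) (h.measurable_distPow q 0 2 0) (distPow_nonneg q X 0 2 0)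
    hN0 2)
  -- Both events together force the added sums above `2 y √(N log N)`, which gives the exponent `(2
  -- y)² / (2 w) = 2 y² / w`.
  refine le_trans (measureReal_mono ?_)
    (htail (fun k ω => min (distPow q X a b k ω) ((N : ℝ) ^ s) +
        min (distPow q X a c k ω) ((N : ℝ) ^ s) - 2 * m) (Finset.range N) w
    ((h.iIndepFun_distPow_pair q a b c).comp
      (fun _ x => min x.1 ((N : ℝ) ^ s) + min x.2 ((N : ℝ) ^ s) - 2 * m) fun _ => by fun_prop)
    (fun k => ?_)
    (fun k => (hid k).symm.memLp_snd ((hL.add hL2).sub (memLp_const _)))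
    (fun k ω => by
      have h1 := min_le_right (distPow q X a b k ω) ((N : ℝ) ^ s)
      have h2 := min_le_right (distPow q X a c k ω) ((N : ℝ) ^ s)
      linarith)
    (fun k => ?_) (fun k => ?_) (by simp))
  · rintro ω ⟨h1, h2⟩
    simp only [Set.mem_ofPred_eq] at h1 h2 ⊢
    have : ∑ k ∈ Finset.range N, (min (distPow q X a b k ω) ((N : ℝ) ^ s) +
        min (distPow q X a c k ω) ((N : ℝ) ^ s) - 2 * m) =
      ∑ k ∈ Finset.range N, (min (distPow q X a b k ω) ((N : ℝ) ^ s) - m) +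
        ∑ k ∈ Finset.range N, (min (distPow q X a c k ω) ((N : ℝ) ^ s) - m) := by
      rw [← Finset.sum_add_distrib]
      exact Finset.sum_congr rfl fun k _ => by ring
    linarith
  · have h1 := h.measurable_distPow q a b k
    have h2 := h.measurable_distPow q a c k
    fun_prop
  · have hi := hL.integrable one_le_two
    have hi2 := hL2.integrable one_le_two
    have hadd : Integrable (fun ω => min (distPow q X 0 1 0 ω) ((N : ℝ) ^ s) +
        min (distPow q X 0 2 0 ω) ((N : ℝ) ^ s)) μ := hi.add hi2
    have e2 := (hid2.comp (u := fun x => min x ((N : ℝ) ^ s)) (by fun_prop)).integral_eq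
    simp only [Function.comp_def] at e2
    rw [(hid k).integral_eq, integral_sub hadd (integrable_const _),
      integral_add hi hi2, e2]
    have := h.integral_min_distPow_le hX hN0
    simp only [integral_const, probReal_univ, smul_eq_mul, one_mul]
    linarith
  · exact (((hid k).comp (u := fun x => x ^ 2) (by fun_prop)).integral_eq).trans_le hN

end IsIIDArray

/-! ### The second moment method. -/

/-- Among couples of cells of a `P × P` grid, `P²` are equal, `P³` share the first index and `P³`
share the second. -/
theorem sum_sum_ite_eq (P : ℕ) (a b : ℝ) :
    ∑ e ∈ Finset.range P ×ˢ Finset.range P, ∑ f ∈ Finset.range P ×ˢ Finset.range P,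
      ((if e = f then a else 0) + (if e.1 = f.1 then b else 0) + (if e.2 = f.2 then b else 0)) =
      (P : ℝ) ^ 2 * a + 2 * (P : ℝ) ^ 3 * b := by
  have key : ∀ e ∈ Finset.range P ×ˢ Finset.range P,
      ∑ f ∈ Finset.range P ×ˢ Finset.range P,
        ((if e = f then a else 0) + (if e.1 = f.1 then b else 0) + (if e.2 = f.2 then b else 0)) =
      a + 2 * P * b := by
    rintro ⟨i, j⟩ he
    have he' := Finset.mem_product.1 he
    have s1 : ∑ f ∈ Finset.range P ×ˢ Finset.range P, (if i = f.1 then b else 0) = P * b := by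
      rw [Finset.sum_product_right]
      simp only [Finset.sum_ite_eq, if_pos he'.1, Finset.sum_const, Finset.card_range, nsmul_eq_mul]
    have s2 : ∑ f ∈ Finset.range P ×ˢ Finset.range P, (if j = f.2 then b else 0) = P * b := by
      rw [Finset.sum_product]
      simp only [Finset.sum_ite_eq, if_pos he'.2, Finset.sum_const, Finset.card_range, nsmul_eq_mul]
    rw [Finset.sum_add_distrib, Finset.sum_add_distrib, Finset.sum_ite_eq, if_pos he, s1, s2]
    ring
  rw [Finset.sum_congr rfl key]
  simp
  ring

/-- Second moment bound for the probability that none of the events `A i j`, `i, j < P`, occurs,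
when events with no common index are independent. -/
theorem measureReal_forall_notMem_le {Ω : Type*} [MeasurableSpace Ω] {μ : Measure Ω}
    [IsProbabilityMeasure μ] {A : ℕ → ℕ → Set Ω} (hA : ∀ i j, MeasurableSet (A i j)) {P : ℕ}
    (hP : 0 < P) {a b : ℝ} (ha : 0 < a) (hb : 0 ≤ b)
    (h1 : ∀ i < P, ∀ j < P, μ.real (A i j) = a)
    (hrow : ∀ i < P, ∀ j < P, ∀ j' < P, j ≠ j' → μ.real (A i j ∩ A i j') ≤ b)
    (hcol : ∀ i < P, ∀ i' < P, ∀ j < P, i ≠ i' → μ.real (A i j ∩ A i' j) ≤ b)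
    (hind : ∀ i < P, ∀ i' < P, ∀ j < P, ∀ j' < P, i ≠ i' → j ≠ j' →
      μ.real (A i j ∩ A i' j') = a ^ 2) :
    μ.real {ω | ∀ i < P, ∀ j < P, ω ∉ A i j} ≤ 1 / ((P : ℝ) ^ 2 * a) + 2 * b / (P * a ^ 2) := by
  set S := Finset.range P ×ˢ Finset.range P with hS
  have hmem : ∀ e ∈ S, e.1 < P ∧ e.2 < P := fun e he => by simpa [hS] using he
  set F : ℕ × ℕ → Ω → ℝ := fun e => (A e.1 e.2).indicator 1 with hF
  have hFi : ∀ e, Integrable (F e) μ := fun e => (integrable_const (1 : ℝ)).indicator (hA _ _)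
  have hFF : ∀ e f, (fun ω => F e ω * F f ω) = (A e.1 e.2 ∩ A f.1 f.2).indicator 1 := fun e f => by
    ext ω
    simp only [hF, Set.inter_indicator_one, Pi.mul_apply]
  have hFFi : ∀ e f, Integrable (fun ω => F e ω * F f ω) μ := fun e f => by
    rw [hFF]; exact (integrable_const (1 : ℝ)).indicator ((hA _ _).inter (hA _ _))
  have hprod : ∀ e f, (fun ω => (F e ω - a) * (F f ω - a)) =
      fun ω => F e ω * F f ω - a * F e ω - a * F f ω + a ^ 2 := fun e f => by ext ω; ring
  have hi1 : ∀ e f, Integrable (fun ω => F e ω * F f ω - a * F e ω) μ := fun e f =>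
    (hFFi e f).sub ((hFi e).const_mul a)
  have hi2 : ∀ e f, Integrable (fun ω => F e ω * F f ω - a * F e ω - a * F f ω) μ := fun e f =>
    (hi1 e f).sub ((hFi f).const_mul a)
  have hpi : ∀ e f, Integrable (fun ω => (F e ω - a) * (F f ω - a)) μ := fun e f => by
    rw [hprod]; exact (hi2 e f).add (integrable_const _)
  have hFint : ∀ e ∈ S, ∫ ω, F e ω ∂μ = a := fun e he => by
    rw [hF, integral_indicator_one (hA _ _)]
    exact h1 _ (hmem e he).1 _ (hmem e he).2
  have hcov : ∀ e ∈ S, ∀ f ∈ S, ∫ ω, (F e ω - a) * (F f ω - a) ∂μ =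
      μ.real (A e.1 e.2 ∩ A f.1 f.2) - a ^ 2 := fun e he f hf => by
    rw [hprod, integral_add (hi2 e f) (integrable_const _),
      integral_sub (hi1 e f) ((hFi f).const_mul a), integral_sub (hFFi e f) ((hFi e).const_mul a),
      integral_const_mul, integral_const_mul, hFint e he, hFint f hf, hFF,
      integral_indicator_one ((hA _ _).inter (hA _ _))]
    simp only [integral_const, probReal_univ, smul_eq_mul, one_mul]
    ring
  have hcovle : ∀ e ∈ S, ∀ f ∈ S, ∫ ω, (F e ω - a) * (F f ω - a) ∂μ ≤
      (if e = f then a else 0) + (if e.1 = f.1 then b else 0) + (if e.2 = f.2 then b else 0) := by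
    rintro ⟨i, j⟩ he ⟨i', j'⟩ hf
    rw [hcov _ he _ hf]
    obtain ⟨hi, hj⟩ := hmem _ he
    obtain ⟨hi', hj'⟩ := hmem _ hf
    simp only at hi hj hi' hj'
    have ha2 : 0 ≤ a ^ 2 := sq_nonneg a
    by_cases e1 : i = i' <;> by_cases e2 : j = j'
    · subst e1 e2
      simp only [Set.inter_self, h1 i hi j hj, if_true]
      linarith
    · subst e1
      have := hrow i hi j hj j' hj' e2
      simp only [Prod.mk.injEq, e2, and_false, if_false, if_true]
      linarith
    · subst e2
      have := hcol i hi i' hi' j hj e1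
      simp only [Prod.mk.injEq, e1, false_and, if_false, if_true]
      linarith
    · simp only [Prod.mk.injEq, e1, e2, false_and, if_false, hind i hi i' hi' j hj j' hj' e1 e2]
      linarith
  have hsq : (fun ω => (∑ e ∈ S, (F e ω - a)) ^ 2) =
      fun ω => ∑ e ∈ S, ∑ f ∈ S, (F e ω - a) * (F f ω - a) := by
    ext ω; rw [sq, Finset.sum_mul_sum]
  have hsqi : Integrable (fun ω => (∑ e ∈ S, (F e ω - a)) ^ 2) μ := by
    rw [hsq]
    exact integrable_finsetSum _ fun e _ => integrable_finsetSum _ fun f _ => hpi e f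
  have hE : ∫ ω, (∑ e ∈ S, (F e ω - a)) ^ 2 ∂μ ≤ (P : ℝ) ^ 2 * a + 2 * (P : ℝ) ^ 3 * b := by
    rw [← sum_sum_ite_eq P a b, hsq,
      integral_finsetSum _ fun e _ => integrable_finsetSum _ fun f _ => hpi e f]
    refine Finset.sum_le_sum fun e he => ?_
    rw [integral_finsetSum _ fun f _ => hpi e f]
    exact Finset.sum_le_sum fun f hf => hcovle e he f hf
  have hmk := mul_meas_ge_le_integral_of_nonneg (ae_of_all μ fun ω =>
    sq_nonneg (∑ e ∈ S, (F e ω - a))) hsqi (((P : ℝ) ^ 2 * a) ^ 2)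
  -- If no event occurs, the centred count equals `-P² a`, so Markov's inequality for its square
  -- applies.
  have hsub : μ.real {ω | ∀ i < P, ∀ j < P, ω ∉ A i j} ≤
      μ.real {ω | ((P : ℝ) ^ 2 * a) ^ 2 ≤ (∑ e ∈ S, (F e ω - a)) ^ 2} := by
    refine measureReal_mono fun ω hω => ?_
    simp only [Set.mem_ofPred_eq] at hω ⊢
    have : ∑ e ∈ S, (F e ω - a) = -((P : ℝ) ^ 2 * a) := by
      rw [Finset.sum_congr rfl (g := fun _ => -a) fun e he => by
        simp [hF, hω _ (hmem e he).1 _ (hmem e he).2]]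
      rw [Finset.sum_const, hS, Finset.card_product, Finset.card_range, nsmul_eq_mul]
      push_cast
      ring
    rw [this, neg_sq]
  have hP' : (0 : ℝ) < P := by exact_mod_cast hP
  have hpos : 0 < ((P : ℝ) ^ 2 * a) ^ 2 := by positivity
  have hfin := (mul_le_mul_of_nonneg_left hsub hpos.le).trans (hmk.trans hE)
  rw [mul_comm, ← le_div_iff₀ hpos] at hfin
  refine hfin.trans_eq ?_
  field_simp

/-- The event that the centred sum of the first `N` powers of distances between the rows `i` and
`j`, truncated at `N ^ s`, is at least `y √(N log N)`. -/
def truncSumGe {Ω : Type*} (q : ℝ) (X : ℕ → ℕ → Ω → ℝ) (s y m : ℝ) (N i j : ℕ) : Set Ω :=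
  {ω | y * sqrtMulLog N ≤ ∑ k ∈ Finset.range N, (min (distPow q X i j k ω) ((N : ℝ) ^ s) - m)}

theorem distPow_comm {Ω : Type*} (q : ℝ) (X : ℕ → ℕ → Ω → ℝ) (i j : ℕ) :
    distPow q X i j = distPow q X j i := by
  ext k ω
  rw [distPow, distPow, abs_sub_comm]

theorem truncSumGe_comm {Ω : Type*} (q : ℝ) (X : ℕ → ℕ → Ω → ℝ) (s y m : ℝ) (N i j : ℕ) :
    truncSumGe q X s y m N i j = truncSumGe q X s y m N j i := by
  rw [truncSumGe, truncSumGe, distPow_comm]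

namespace IsIIDArray

set_option linter.unusedSectionVars false

variable {Ω : Type*} [MeasurableSpace Ω] {μ : Measure Ω} [IsProbabilityMeasure μ]
  {X : ℕ → ℕ → Ω → ℝ}

theorem measurable_sum_min_sub (q M m : ℝ) (N : ℕ) : Measurable fun z : (ℕ → ℝ) × (ℕ → ℝ) =>
    ∑ k ∈ Finset.range N, (min (|z.1 k - z.2 k| ^ q) M - m) := by
  fun_prop

theorem measurableSet_truncSumGe (h : IsIIDArray X μ) (q s y m : ℝ) (N i j : ℕ) :
    MeasurableSet (truncSumGe q X s y m N i j) :=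
  (measurable_sum_min_sub q ((N : ℝ) ^ s) m N).comp ((h.measurable_row i).prodMk (h.measurable_row j))
    (measurableSet_Ici (a := y * sqrtMulLog N))

theorem measureReal_truncSumGe_eq (h : IsIIDArray X μ) (q s y m : ℝ) (N : ℕ) {i j : ℕ}
    (hij : i ≠ j) :
    μ.real (truncSumGe q X s y m N i j) = μ.real (truncSumGe q X s y m N 0 1) :=
  congrArg ENNReal.toReal (((h.identDistrib_rows hij).comp
    (measurable_sum_min_sub q ((N : ℝ) ^ s) m N)).measure_mem_eq
      (measurableSet_Ici (a := y * sqrtMulLog N)))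

theorem measureReal_truncSumGe_inter_eq (h : IsIIDArray X μ) (q s y m : ℝ) (N : ℕ) {i j i' j' : ℕ}
    (hij : i ≠ j) (hij' : i' ≠ j') (h1 : i ≠ i') (h2 : i ≠ j') (h3 : j ≠ i') (h4 : j ≠ j') :
    μ.real (truncSumGe q X s y m N i j ∩ truncSumGe q X s y m N i' j') =
      μ.real (truncSumGe q X s y m N 0 1) ^ 2 := by
  have hi := (h.iIndepFun_rows.indepFun_prodMk_prodMk h.measurable_row i j i' j' h1 h2 h3 h4).comp
    (measurable_sum_min_sub q ((N : ℝ) ^ s) m N) (measurable_sum_min_sub q ((N : ℝ) ^ s) m N)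
  have h5 := congrArg ENNReal.toReal (hi.measure_inter_preimage_eq_mul
    (Set.Ici (y * sqrtMulLog N)) (Set.Ici (y * sqrtMulLog N)) measurableSet_Ici measurableSet_Ici)
  rw [ENNReal.toReal_mul] at h5
  rw [sq]
  nth_rewrite 1 [← h.measureReal_truncSumGe_eq q s y m N hij]
  rw [← h.measureReal_truncSumGe_eq q s y m N hij']
  exact h5

/-- Lower moderate deviation bound for sums of truncated powers of distances. -/
theorem eventually_rpow_le_measureReal_truncSumGe (h : IsIIDArray X μ) {q s r y α v m : ℝ}
    (hX : MemLp (distPow q X 0 1 0) 2 μ) (hm : ∫ ω, distPow q X 0 1 0 ω ∂μ = m)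
    (hv : variance (distPow q X 0 1 0) μ = v) (hv0 : 0 < v)
    (hr : 0 < r) (hXr : Integrable (fun ω => distPow q X 0 1 0 ω ^ r) μ)
    (hy : 0 < y) (hα : y ^ 2 / (2 * v) < α) (hα' : α < s * r - 1) :
    ∀ᶠ N : ℕ in atTop, (N : ℝ) ^ (-α) ≤ μ.real (truncSumGe q X s y m N 0 1) := by
  obtain ⟨α', h1, h2⟩ := exists_between hα
  set C := ∫ ω, distPow q X 0 1 0 ω ^ r ∂μ with hC
  filter_upwards [eventually_rpow_le_measureReal_sum (h.iIndepFun_distPow q 0 1)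
      (h.measurable_distPow q 0 1) (fun k => h.identDistrib_distPow q (by decide) k) hX
      (distPow_nonneg q X 0 1) hv hv0 hm hy h1,
    eventually_const_mul_rpow_le (neg_lt_neg h2) 2,
    eventually_const_mul_rpow_le (neg_lt_neg hα') C, eventually_ge_atTop 1]
    with N hN hN2 hN3 hN1
  have hN0 : (0 : ℝ) < N := by exact_mod_cast hN1
  have hNs : 0 < (N : ℝ) ^ s := by positivity
  -- Truncation changes the sum only if some term exceeds `N ^ s`, which has probability at most `C
  -- N ^ (1 - s r)`, negligible against `N ^ (-α)`.
  have hsub : {ω | y * sqrtMulLog N + N * m ≤ ∑ k ∈ Finset.range N, distPow q X 0 1 k ω} ⊆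
      truncSumGe q X s y m N 0 1 ∪ ⋃ k ∈ Finset.range N, {ω | (N : ℝ) ^ s < distPow q X 0 1 k ω} := by
    intro ω hω
    by_cases hb : ∃ k ∈ Finset.range N, (N : ℝ) ^ s < distPow q X 0 1 k ω
    · right
      simpa using hb
    · left
      push Not at hb
      simp only [Set.mem_ofPred_eq] at hω
      simp only [truncSumGe, Set.mem_ofPred_eq]
      rw [Finset.sum_congr rfl fun k hk => by rw [min_eq_left (hb k hk)], Finset.sum_sub_distrib]
      simp only [Finset.sum_const, Finset.card_range, nsmul_eq_mul]
      linarith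
  have hle := (measureReal_mono hsub (measure_ne_top μ _)).trans (measureReal_union_le _ _)
  have hbad : μ.real (⋃ k ∈ Finset.range N, {ω | (N : ℝ) ^ s < distPow q X 0 1 k ω}) ≤
      C * (N : ℝ) ^ (-(s * r - 1)) := by
    refine (measureReal_biUnion_finset_le _ _).trans ((Finset.sum_le_sum fun k _ =>
      h.measureReal_lt_distPow_le hr hXr hNs (by decide) k).trans_eq ?_)
    rw [Finset.sum_const, Finset.card_range, nsmul_eq_mul, ← hC, ← Real.rpow_mul hN0.le,
      show -(s * r - 1) = 1 + s * -r by ring, Real.rpow_add hN0, Real.rpow_one]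
    ring
  linarith

/-- With high probability some truncated sum between the first and the second block of `P N` rows
is large. -/
theorem exists_eventually_measureReal_forall_notMem_le (h : IsIIDArray X μ)
    {q s r y τ c v m : ℝ} {P : ℕ → ℕ}
    (hX : MemLp (distPow q X 0 1 0) 2 μ) (hm : ∫ ω, distPow q X 0 1 0 ω ∂μ = m)
    (hv : variance (distPow q X 0 1 0) μ = v) (hv0 : 0 < v)
    (hcov : covariance (distPow q X 0 1 0) (distPow q X 0 2 0) μ < v / 3)
    (hr : 0 < r) (hXr : Integrable (fun ω => distPow q X 0 1 0 ω ^ r) μ)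
    (hs0 : 0 < s) (hs : s < 1 / 2) (hsr : 2 * τ + 1 ≤ s * r) (hc : 0 < c)
    (hP : ∀ᶠ N : ℕ in atTop, c * (N : ℝ) ^ τ ≤ P N)
    (hy : 0 < y) (hyτ : y ^ 2 / (2 * v) < 2 * τ) :
    ∃ A η : ℝ, 0 < η ∧ ∀ᶠ N : ℕ in atTop,
      μ.real {ω | ∀ i < P N, ∀ j < P N, ω ∉ truncSumGe q X s y m N i (P N + j)} ≤
        A * (N : ℝ) ^ (-η) := by
  set z := y ^ 2 / (2 * v) with hz
  -- With this `δ` the two error exponents are `2 τ - α = 7 δ` and `β + τ - 2 α = δ`, both positive.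
  set δ := (2 * τ - z) / 8 with hδ
  have hδ0 : 0 < δ := by rw [hδ]; linarith
  obtain ⟨α, hα⟩ : ∃ α, α = z + δ := ⟨_, rfl⟩
  obtain ⟨β, hβ⟩ : ∃ β, β = 3 / 2 * z - δ := ⟨_, rfl⟩
  have hβ' : β < 2 * y ^ 2 / (8 / 3 * v) := by
    have : 2 * y ^ 2 / (8 / 3 * v) = 3 / 2 * z := by rw [hz]; field_simp; norm_num
    linarith
  refine ⟨c⁻¹ ^ 2 + 2 * c⁻¹, min (2 * τ - α) (β + τ - 2 * α), lt_min (by linarith) (by linarith), ?_⟩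
  filter_upwards [h.eventually_rpow_le_measureReal_truncSumGe (α := α) hX hm hv hv0 hr hXr hy
      (by linarith) (by linarith) (s := s), hP,
    h.eventually_measureReal_inter_le (w := 8 / 3 * v) (β := β) (s := s) hX hm
      (by rw [hv]; linarith) (by linarith) hs0 hs hy hβ', eventually_ge_atTop 1]
    with N ha hPN hb hN1
  have hN1' : (1 : ℝ) ≤ N := by exact_mod_cast hN1
  have hN0 : (0 : ℝ) < N := by linarith
  have hP0' : (0 : ℝ) < P N := lt_of_lt_of_le (by positivity) hPN
  have hP0 : 0 < P N := by exact_mod_cast hP0'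
  set a := μ.real (truncSumGe q X s y m N 0 1) with hadef
  have ha0 : 0 < a := lt_of_lt_of_le (by positivity) ha
  -- The two rows of a pair come from disjoint blocks, so cells with `i ≠ i'` and `j ≠ j'` involve
  -- four distinct rows and are independent.
  have key := measureReal_forall_notMem_le (μ := μ)
    (A := fun i j => truncSumGe q X s y m N i (P N + j))
    (fun i j => h.measurableSet_truncSumGe q s y m N i _) hP0 ha0
    (b := (N : ℝ) ^ (-β)) (by positivity)
    (fun i hi j _ => h.measureReal_truncSumGe_eq q s y m N (by omega))
    (fun i hi j hj j' hj' hjj => hb i (P N + j) (P N + j') (by omega) (by omega) (by omega))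
    (fun i hi i' hi' j hj hii => by
      rw [truncSumGe_comm q X s y m N i, truncSumGe_comm q X s y m N i']
      exact hb (P N + j) i i' (by omega) (by omega) hii)
    (fun i hi i' hi' j hj j' hj' hii hjj => h.measureReal_truncSumGe_inter_eq q s y m N (by omega)
      (by omega) hii (by omega) (by omega) (by omega))
  refine key.trans ?_
  have e1 : 1 / ((P N : ℝ) ^ 2 * a) ≤ c⁻¹ ^ 2 * (N : ℝ) ^ (-(2 * τ - α)) := by
    calc 1 / ((P N : ℝ) ^ 2 * a) ≤ 1 / ((c * (N : ℝ) ^ τ) ^ 2 * (N : ℝ) ^ (-α)) := by gcongr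
      _ = _ := by
        rw [show -(2 * τ - α) = -τ + -τ + α by ring, Real.rpow_add hN0, Real.rpow_add hN0,
          Real.rpow_neg hN0.le τ, Real.rpow_neg hN0.le α]
        field_simp
  have e2 : 2 * (N : ℝ) ^ (-β) / (P N * a ^ 2) ≤ 2 * c⁻¹ * (N : ℝ) ^ (-(β + τ - 2 * α)) := by
    calc 2 * (N : ℝ) ^ (-β) / (P N * a ^ 2)
        ≤ 2 * (N : ℝ) ^ (-β) / (c * (N : ℝ) ^ τ * ((N : ℝ) ^ (-α)) ^ 2) := by gcongr
      _ = _ := by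
        rw [show -(β + τ - 2 * α) = -β + -τ + α + α by ring, Real.rpow_add hN0,
          Real.rpow_add hN0, Real.rpow_add hN0, Real.rpow_neg hN0.le τ, Real.rpow_neg hN0.le α]
        field_simp
  have e3 : (N : ℝ) ^ (-(2 * τ - α)) ≤ (N : ℝ) ^ (-min (2 * τ - α) (β + τ - 2 * α)) :=
    Real.rpow_le_rpow_of_exponent_le hN1' (neg_le_neg (min_le_left _ _))
  have e4 : (N : ℝ) ^ (-(β + τ - 2 * α)) ≤ (N : ℝ) ^ (-min (2 * τ - α) (β + τ - 2 * α)) :=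
    Real.rpow_le_rpow_of_exponent_le hN1' (neg_le_neg (min_le_right _ _))
  calc _ ≤ c⁻¹ ^ 2 * (N : ℝ) ^ (-(2 * τ - α)) + 2 * c⁻¹ * (N : ℝ) ^ (-(β + τ - 2 * α)) :=
        add_le_add e1 e2
    _ ≤ c⁻¹ ^ 2 * (N : ℝ) ^ (-min (2 * τ - α) (β + τ - 2 * α)) +
        2 * c⁻¹ * (N : ℝ) ^ (-min (2 * τ - α) (β + τ - 2 * α)) := by gcongr
    _ = _ := by ring

end IsIIDArray

/-! ### Interpolation between the points of a geometric sequence. -/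

theorem sqrtMulLog_nonneg (n : ℕ) : 0 ≤ sqrtMulLog n := Real.sqrt_nonneg _

theorem sqrtMulLog_le {N n : ℕ} (hN : 1 ≤ N) (h : N ≤ n) : sqrtMulLog N ≤ sqrtMulLog n := by
  have h1 : (1 : ℝ) ≤ N := by exact_mod_cast hN
  have h2 : (N : ℝ) ≤ n := by exact_mod_cast h
  have h3 : 0 ≤ Real.log N := Real.log_nonneg h1
  unfold sqrtMulLog
  gcongr

theorem eventually_sqrtMulLog_le_mul {ρ : ℝ} (hρ : 1 < ρ) :
    ∀ᶠ N : ℕ in atTop, ∀ n : ℕ, 1 ≤ n → (n : ℝ) ≤ ρ * N → sqrtMulLog n ≤ ρ * sqrtMulLog N := by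
  have hlog : Tendsto (fun N : ℕ => (ρ - 1) * Real.log N) atTop atTop :=
    (Real.tendsto_log_atTop.comp tendsto_natCast_atTop_atTop).const_mul_atTop (sub_pos.2 hρ)
  have hρ0 : 0 < ρ := by linarith
  filter_upwards [hlog.eventually_ge_atTop (Real.log ρ), eventually_ge_atTop 1]
    with N hN hN1 n hn1 hn
  have hN0 : (0 : ℝ) < N := by exact_mod_cast hN1
  have hn0 : (0 : ℝ) < n := by exact_mod_cast hn1
  have hl : 0 ≤ Real.log n := Real.log_nonneg (by exact_mod_cast hn1)
  have h1 : Real.log n ≤ ρ * Real.log N := by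
    have := Real.log_le_log hn0 hn
    rw [Real.log_mul hρ0.ne' hN0.ne'] at this
    linarith
  unfold sqrtMulLog
  rw [← Real.sqrt_sq hρ0.le, ← Real.sqrt_mul (sq_nonneg ρ)]
  refine Real.sqrt_le_sqrt ?_
  calc n * Real.log n ≤ (ρ * N) * (ρ * Real.log N) := by gcongr
    _ = _ := by ring

/-- Every large integer lies in one of the blocks `[⌈ρ ^ k⌉, ρ ⌈ρ ^ k⌉]`. -/
theorem eventually_of_eventually_geometric {ρ : ℝ} (hρ : 1 < ρ) {Q : ℕ → Prop}
    (hQ : ∀ᶠ k : ℕ in atTop, ∀ n : ℕ, ⌈ρ ^ k⌉₊ ≤ n → (n : ℝ) ≤ ρ * ⌈ρ ^ k⌉₊ → Q n) :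
    ∀ᶠ n in atTop, Q n := by
  obtain ⟨K, hK⟩ := eventually_atTop.1 hQ
  have hρ0 : 0 < ρ := by linarith
  filter_upwards [eventually_ge_atTop 1, eventually_ge_atTop ⌈ρ ^ K⌉₊] with n hn hnK
  obtain ⟨k, h1, h2⟩ := exists_nat_pow_near (x := (n : ℝ)) (by exact_mod_cast hn) hρ
  refine hK k ?_ n (Nat.ceil_le.2 h1) (h2.le.trans ?_)
  · by_contra hlt
    have h3 : ρ ^ (k + 1) ≤ ρ ^ K := pow_le_pow_right₀ hρ.le (by omega)
    linarith [Nat.ceil_le.1 hnK]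
  · rw [pow_succ, mul_comm]
    gcongr
    exact Nat.le_ceil _

/-- Borel–Cantelli along the blocks for polynomially many events indexed by two rows and a third
index. -/
theorem ae_eventually_rows_notMem {Ω : Type*} [MeasurableSpace Ω] {μ : Measure Ω}
    [IsProbabilityMeasure μ] {B : ℕ → ℕ → ℕ → ℕ → Set Ω} {R T : ℕ → ℕ} {c c' τ γ β A ρ : ℝ}
    (hρ : 1 < ρ) (hβ : 2 * τ + γ < β) (hA : 0 ≤ A) (hc : 0 ≤ c)
    (hR : ∀ N : ℕ, 1 ≤ N → (R N : ℝ) ≤ c * (N : ℝ) ^ τ)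
    (hT : ∀ N : ℕ, 1 ≤ N → (T N : ℝ) ≤ c' * (N : ℝ) ^ γ)
    (hB : ∀ᶠ N : ℕ in atTop, ∀ i j : ℕ, i ≠ j → ∀ t < T N, μ.real (B N i j t) ≤ A * (N : ℝ) ^ (-β)) :
    ∀ᵐ ω ∂μ, ∀ᶠ k : ℕ in atTop, ∀ i < R ⌈ρ ^ k⌉₊, ∀ j < R ⌈ρ ^ k⌉₊, i ≠ j → ∀ t < T ⌈ρ ^ k⌉₊,
      ω ∉ B ⌈ρ ^ k⌉₊ i j t := by
  have h := ae_eventually_notMem_of_measureReal_le_rpow (μ := μ) (A := c ^ 2 * c' * A)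
    (E := fun N => ⋃ e ∈ ((Finset.range (R N) ×ˢ Finset.range (R N)).filter fun e => e.1 ≠ e.2) ×ˢ
      Finset.range (T N), B N e.1.1 e.1.2 e.2) (sub_pos.2 hβ) hρ ?_
  · filter_upwards [h] with ω hω
    filter_upwards [hω] with k hk i hi j hj hij t ht hmem
    refine hk (Set.mem_biUnion (x := ((i, j), t)) ?_ hmem)
    simp [hi, hj, hij, ht]
  · filter_upwards [hB, eventually_ge_atTop 1] with N hN hN1
    have hN0 : (0 : ℝ) < N := by exact_mod_cast hN1
    refine (measureReal_biUnion_finset_le _ _).trans ?_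
    calc _ ≤ ∑ e ∈ ((Finset.range (R N) ×ˢ Finset.range (R N)).filter fun e => e.1 ≠ e.2) ×ˢ
          Finset.range (T N), A * (N : ℝ) ^ (-β) := by
          refine Finset.sum_le_sum fun e he => ?_
          simp only [Finset.mem_product, Finset.mem_filter, Finset.mem_range] at he
          exact hN _ _ he.1.2 _ he.2
      _ ≤ ((R N : ℝ) * R N * T N) * (A * (N : ℝ) ^ (-β)) := by
          rw [Finset.sum_const, nsmul_eq_mul, Finset.card_product, Finset.card_range]
          push_cast
          gcongr
          have := Finset.card_filter_le (Finset.range (R N) ×ˢ Finset.range (R N))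
            fun e => e.1 ≠ e.2
          rw [Finset.card_product, Finset.card_range] at this
          exact_mod_cast this
      _ ≤ ((c * (N : ℝ) ^ τ) * (c * (N : ℝ) ^ τ) * (c' * (N : ℝ) ^ γ)) * (A * (N : ℝ) ^ (-β)) := by
          have h1 := hR N hN1
          have h2 := hT N hN1
          gcongr
      _ = _ := by
          rw [show -(β - (2 * τ + γ)) = τ + τ + γ + -β by ring, Real.rpow_add hN0,
            Real.rpow_add hN0, Real.rpow_add hN0]
          ring

theorem ceil_const_mul_rpow_le {c τ : ℝ} (hc : 0 ≤ c) (hτ : 0 ≤ τ) {N : ℕ} (hN : 1 ≤ N) :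
    (⌈c * (N : ℝ) ^ τ⌉₊ : ℝ) ≤ (c + 1) * (N : ℝ) ^ τ := by
  have h1 : (1 : ℝ) ≤ (N : ℝ) ^ τ := Real.one_le_rpow (by exact_mod_cast hN) hτ
  have h2 := (Nat.ceil_lt_add_one (a := c * (N : ℝ) ^ τ) (by positivity)).le
  linarith

theorem floor_const_mul_add_one_le {ρ : ℝ} (hρ : 0 ≤ ρ) {N : ℕ} (hN : 1 ≤ N) :
    ((⌊ρ * N⌋₊ + 1 : ℕ) : ℝ) ≤ (ρ + 1) * (N : ℝ) ^ (1 : ℝ) := by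
  have h1 : (1 : ℝ) ≤ N := by exact_mod_cast hN
  have h2 := Nat.floor_le (a := ρ * N) (by positivity)
  push_cast
  rw [Real.rpow_one]
  linarith

/-! ### Almost sure control of terms, sums and increments over each block. -/

namespace IsIIDArray

set_option linter.unusedSectionVars false

variable {Ω : Type*} [MeasurableSpace Ω] {μ : Measure Ω} [IsProbabilityMeasure μ]
  {X : ℕ → ℕ → Ω → ℝ}

/-- About `N ^ (2 τ + 1)` terms are involved, each exceeding `N ^ s` with probability `O(N ^ (-s
r))`; hence truncation is eventually inactive on the whole block. -/
theorem ae_eventually_distPow_le (h : IsIIDArray X μ) {q s r τ c ρ : ℝ} (hr : 0 < r)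
    (hXr : Integrable (fun ω => distPow q X 0 1 0 ω ^ r) μ) (hsr : 2 * τ + 1 < s * r)
    (hτ : 0 ≤ τ) (hc : 0 ≤ c) (hρ : 1 < ρ) :
    ∀ᵐ ω ∂μ, ∀ᶠ k : ℕ in atTop, ∀ i < ⌈c * (⌈ρ ^ k⌉₊ : ℝ) ^ τ⌉₊, ∀ j < ⌈c * (⌈ρ ^ k⌉₊ : ℝ) ^ τ⌉₊,
      i ≠ j → ∀ t < ⌊ρ * ⌈ρ ^ k⌉₊⌋₊ + 1, distPow q X i j t ω ≤ (⌈ρ ^ k⌉₊ : ℝ) ^ s := by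
  have key := ae_eventually_rows_notMem (μ := μ) (τ := τ) (γ := 1) (β := s * r)
    (B := fun N i j t => {ω | (N : ℝ) ^ s < distPow q X i j t ω})
    (R := fun N => ⌈c * (N : ℝ) ^ τ⌉₊) (T := fun N => ⌊ρ * N⌋₊ + 1)
    (A := ∫ ω, distPow q X 0 1 0 ω ^ r ∂μ) (c := c + 1) (c' := ρ + 1) hρ hsr
    (integral_nonneg fun ω => Real.rpow_nonneg (distPow_nonneg q X 0 1 0 ω) r) (by linarith)
    (fun N hN => ceil_const_mul_rpow_le hc hτ hN)
    (fun N hN => floor_const_mul_add_one_le (by linarith) hN) ?_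
  · simpa only [Set.mem_ofPred_eq, not_lt] using key
  · filter_upwards [eventually_ge_atTop 1] with N hN i j hij t _
    have hN0 : (0 : ℝ) < N := by exact_mod_cast hN
    have := h.measureReal_lt_distPow_le hr hXr (t := (N : ℝ) ^ s) (by positivity) hij t
    rwa [← Real.rpow_mul hN0.le, mul_neg] at this

theorem ae_eventually_sum_min_lt (h : IsIIDArray X μ) {q s y τ c ρ v m : ℝ}
    (hX : MemLp (distPow q X 0 1 0) 2 μ) (hm : ∫ ω, distPow q X 0 1 0 ω ∂μ = m)
    (hv : variance (distPow q X 0 1 0) μ = v) (hv0 : 0 < v) (hs0 : 0 < s) (hs : s < 1 / 2)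
    (hτ : 0 ≤ τ) (hc : 0 ≤ c) (hρ : 1 < ρ) (hy : 0 < y) (hyτ : 2 * τ < y ^ 2 / (2 * v)) :
    ∀ᵐ ω ∂μ, ∀ᶠ k : ℕ in atTop, ∀ i < ⌈c * (⌈ρ ^ k⌉₊ : ℝ) ^ τ⌉₊, ∀ j < ⌈c * (⌈ρ ^ k⌉₊ : ℝ) ^ τ⌉₊,
      i ≠ j → ∑ t ∈ Finset.range ⌈ρ ^ k⌉₊, (min (distPow q X i j t ω) ((⌈ρ ^ k⌉₊ : ℝ) ^ s) - m) <
        y * sqrtMulLog ⌈ρ ^ k⌉₊ := by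
  obtain ⟨β, hβ1, hβ2⟩ := exists_between hyτ
  have key := ae_eventually_rows_notMem (μ := μ) (τ := τ) (γ := 0) (β := β)
    (B := fun N i j _ => {ω | y * sqrtMulLog N ≤
      ∑ t ∈ Finset.range N, (min (distPow q X i j t ω) ((N : ℝ) ^ s) - m)})
    -- Only the left end of the block matters here, so the third index is trivial.
    (R := fun N => ⌈c * (N : ℝ) ^ τ⌉₊) (T := fun _ => 1)
    (A := 1) (c := c + 1) (c' := 1) hρ (by linarith) zero_le_one (by linarith)
    (fun N hN => ceil_const_mul_rpow_le hc hτ hN) (fun N hN => by simp) ?_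
  · simpa only [Set.mem_ofPred_eq, not_le, Nat.lt_one_iff, forall_eq] using key
  · filter_upwards [h.eventually_measureReal_sum_min_le (κ := 1) (β := β) hX hm hv hv0 hs0 hs hy
      one_pos (by linarith) (by rwa [one_mul])] with N hN i j hij t _
    rw [one_mul]
    exact hN i j hij _ (by simp)

theorem card_Ico_le {ρ : ℝ} (hρ : 1 < ρ) {N t : ℕ} (ht : t < ⌊ρ * N⌋₊ + 1) :
    ((Finset.Ico N t).card : ℝ) ≤ (ρ - 1) * N := by
  have h1 : (t : ℝ) ≤ ρ * N := (Nat.le_floor_iff (by positivity)).1 (Nat.lt_succ_iff.1 ht)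
  rw [Nat.card_Ico]
  rcases le_total t N with h | h
  · rw [Nat.sub_eq_zero_of_le h]
    have : 0 ≤ (ρ - 1) * N := mul_nonneg (by linarith) (Nat.cast_nonneg _)
    simpa using this
  · rw [Nat.cast_sub h]
    linarith

/-- The factor `ρ - 1` makes the tail exponent large enough to sum over every endpoint `n` as well,
which replaces a maximal inequality. -/
theorem ae_eventually_increment_min_lt (h : IsIIDArray X μ) {q s y τ c ρ v m : ℝ}
    (hX : MemLp (distPow q X 0 1 0) 2 μ) (hm : ∫ ω, distPow q X 0 1 0 ω ∂μ = m)
    (hv : variance (distPow q X 0 1 0) μ = v) (hv0 : 0 < v) (hs0 : 0 < s) (hs : s < 1 / 2)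
    (hτ : 0 ≤ τ) (hc : 0 ≤ c) (hρ : 1 < ρ) (hy : 0 < y)
    (hyτ : 2 * τ + 1 < y ^ 2 / (2 * ((ρ - 1) * v))) :
    ∀ᵐ ω ∂μ, ∀ᶠ k : ℕ in atTop, ∀ i < ⌈c * (⌈ρ ^ k⌉₊ : ℝ) ^ τ⌉₊, ∀ j < ⌈c * (⌈ρ ^ k⌉₊ : ℝ) ^ τ⌉₊,
      i ≠ j → ∀ n < ⌊ρ * ⌈ρ ^ k⌉₊⌋₊ + 1,
      ∑ t ∈ Finset.Ico ⌈ρ ^ k⌉₊ n, (min (distPow q X i j t ω) ((⌈ρ ^ k⌉₊ : ℝ) ^ s) - m) <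
        y * sqrtMulLog ⌈ρ ^ k⌉₊ := by
  obtain ⟨β, hβ1, hβ2⟩ := exists_between hyτ
  have key := ae_eventually_rows_notMem (μ := μ) (τ := τ) (γ := 1) (β := β)
    (B := fun N i j n => {ω | y * sqrtMulLog N ≤
      ∑ t ∈ Finset.Ico N n, (min (distPow q X i j t ω) ((N : ℝ) ^ s) - m)})
    (R := fun N => ⌈c * (N : ℝ) ^ τ⌉₊) (T := fun N => ⌊ρ * N⌋₊ + 1)
    (A := 1) (c := c + 1) (c' := ρ + 1) hρ (by linarith) zero_le_one (by linarith)
    (fun N hN => ceil_const_mul_rpow_le hc hτ hN)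
    (fun N hN => floor_const_mul_add_one_le (by linarith) hN) ?_
  · simpa only [Set.mem_ofPred_eq, not_le] using key
  · filter_upwards [h.eventually_measureReal_sum_min_le (κ := ρ - 1) (β := β) hX hm hv hv0 hs0 hs hy
      (sub_pos.2 hρ) (by linarith) hβ2] with N hN i j hij n hn
    rw [one_mul]
    exact hN i j hij _ (card_Ico_le hρ hn)

theorem ae_eventually_increment_sub_lt (h : IsIIDArray X μ) {q y τ c ρ v m : ℝ}
    (hX : MemLp (distPow q X 0 1 0) 2 μ) (hm : ∫ ω, distPow q X 0 1 0 ω ∂μ = m)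
    (hv : variance (distPow q X 0 1 0) μ = v) (hv0 : 0 < v)
    (hτ : 0 ≤ τ) (hc : 0 ≤ c) (hρ : 1 < ρ) (hy : 0 < y)
    (hyτ : 2 * τ + 1 < y ^ 2 / (2 * ((ρ - 1) * v))) :
    ∀ᵐ ω ∂μ, ∀ᶠ k : ℕ in atTop, ∀ i < ⌈c * (⌈ρ ^ k⌉₊ : ℝ) ^ τ⌉₊, ∀ j < ⌈c * (⌈ρ ^ k⌉₊ : ℝ) ^ τ⌉₊,
      i ≠ j → ∀ n < ⌊ρ * ⌈ρ ^ k⌉₊⌋₊ + 1,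
      ∑ t ∈ Finset.Ico ⌈ρ ^ k⌉₊ n, (m - distPow q X i j t ω) < y * sqrtMulLog ⌈ρ ^ k⌉₊ := by
  obtain ⟨β, hβ1, hβ2⟩ := exists_between hyτ
  have key := ae_eventually_rows_notMem (μ := μ) (τ := τ) (γ := 1) (β := β)
    (B := fun N i j n => {ω | y * sqrtMulLog N ≤ ∑ t ∈ Finset.Ico N n, (m - distPow q X i j t ω)})
    (R := fun N => ⌈c * (N : ℝ) ^ τ⌉₊) (T := fun N => ⌊ρ * N⌋₊ + 1)
    (A := 1) (c := c + 1) (c' := ρ + 1) hρ (by linarith) zero_le_one (by linarith)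
    (fun N hN => ceil_const_mul_rpow_le hc hτ hN)
    (fun N hN => floor_const_mul_add_one_le (by linarith) hN) ?_
  · simpa only [Set.mem_ofPred_eq, not_le] using key
  · filter_upwards [h.eventually_measureReal_sum_sub_le (κ := ρ - 1) (β := β) hX hm hv hv0 hy
      (sub_pos.2 hρ) hβ2] with N hN i j hij n hn
    rw [one_mul]
    exact hN i j hij _ (card_Ico_le hρ hn)

end IsIIDArray

/-- Any slack `e` in the level covers the increments once `ρ` is near `1`. The cap `a` limits the
growth of the normalisation over a block. -/
theorem exists_one_lt_and_lt_div {a b e v : ℝ} (ha : 1 < a) (he : 0 < e) (hv : 0 < v) (hb : 0 < b) :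
    ∃ ρ, 1 < ρ ∧ ρ ≤ a ∧ b < e ^ 2 / (2 * ((ρ - 1) * v)) := by
  have hd : 0 < e ^ 2 / (2 * (v * b)) := by positivity
  obtain ⟨ρ, h1, h2⟩ := exists_between (a₁ := 1) (a₂ := min a (1 + e ^ 2 / (2 * (v * b))))
    (lt_min ha (by linarith))
  refine ⟨ρ, h1, (h2.trans_le (min_le_left _ _)).le, ?_⟩
  have h3 : ρ - 1 < e ^ 2 / (2 * (v * b)) := by linarith [h2.trans_le (min_le_right _ _)]
  have h4 : 0 < ρ - 1 := by linarith
  rw [lt_div_iff₀ (by positivity)] at h3 ⊢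
  linarith

/-! ### The almost sure upper and lower bounds. -/

namespace IsIIDArray

variable {Ω : Type*} [MeasurableSpace Ω] {μ : Measure Ω} [IsProbabilityMeasure μ]
  {X : ℕ → ℕ → Ω → ℝ}

/-- Almost surely, eventually all centred sums are below `y √(n log n)`, if `y² > 4 τ v`. -/
theorem ae_eventually_forall_sum_le (h : IsIIDArray X μ) {q s r y τ c v m : ℝ} {p : ℕ → ℕ}
    (hX : MemLp (distPow q X 0 1 0) 2 μ) (hm : ∫ ω, distPow q X 0 1 0 ω ∂μ = m)
    (hv : variance (distPow q X 0 1 0) μ = v) (hv0 : 0 < v)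
    (hr : 0 < r) (hXr : Integrable (fun ω => distPow q X 0 1 0 ω ^ r) μ)
    (hs0 : 0 < s) (hs : s < 1 / 2) (hsr : 2 * τ + 1 < s * r) (hτ : 0 < τ) (hc : 0 ≤ c)
    (hp : ∀ n : ℕ, 1 ≤ n → (p n : ℝ) ≤ c * (n : ℝ) ^ τ)
    (hy : 0 < y) (hyτ : 2 * τ < y ^ 2 / (2 * v)) :
    ∀ᵐ ω ∂μ, ∀ᶠ n : ℕ in atTop, ∀ i < p n, ∀ j < p n, i ≠ j →
      ∑ k ∈ Finset.range n, distPow q X i j k ω ≤ n * m + y * sqrtMulLog n := by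
  -- The level `y` is split: `y'`, still supercritical, for the sum up to `N`, and `y - y'` for the
  -- increment up to `n`.
  obtain ⟨y', hy'0, hy'y, hy'⟩ : ∃ y', 0 < y' ∧ y' < y ∧ 2 * τ < y' ^ 2 / (2 * v) := by
    rw [lt_div_iff₀ (by positivity)] at hyτ
    obtain ⟨y', h1, h2⟩ := exists_between ((Real.sqrt_lt' hy).2 hyτ)
    refine ⟨y', (Real.sqrt_nonneg _).trans_lt h1, h2, ?_⟩
    rw [lt_div_iff₀ (by positivity)]
    exact (Real.sqrt_lt' ((Real.sqrt_nonneg _).trans_lt h1)).1 h1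
  obtain ⟨ρ, hρ, -, hρy⟩ := exists_one_lt_and_lt_div one_lt_two (sub_pos.2 hy'y) hv0
    (by linarith : 0 < 2 * τ + 1)
  have hρ0 : 0 < ρ := by linarith
  have hcρ : 0 ≤ c * ρ ^ τ := by positivity
  filter_upwards [h.ae_eventually_distPow_le hr hXr hsr hτ.le hcρ hρ,
    h.ae_eventually_sum_min_lt hX hm hv hv0 hs0 hs hτ.le hcρ hρ hy'0 hy',
    h.ae_eventually_increment_min_lt hX hm hv hv0 hs0 hs hτ.le hcρ hρ (sub_pos.2 hy'y) hρy]
    with ω h1 h2 h3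
  refine eventually_of_eventually_geometric hρ ?_
  filter_upwards [h1, h2, h3] with k h1 h2 h3 n hNn hnN i hi j hj hij
  set N := ⌈ρ ^ k⌉₊ with hN
  have hN1 : 1 ≤ N := Nat.one_le_ceil_iff.2 (by positivity)
  -- The factor `ρ ^ τ` makes one range of rows serve every `n` in the block.
  have hpn : p n ≤ ⌈c * ρ ^ τ * (N : ℝ) ^ τ⌉₊ := by
    have : (p n : ℝ) ≤ c * ρ ^ τ * (N : ℝ) ^ τ := by
      refine (hp n (hN1.trans hNn)).trans ?_
      rw [mul_assoc, ← Real.mul_rpow hρ0.le (Nat.cast_nonneg N)]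
      gcongr
    exact_mod_cast this.trans (Nat.le_ceil _)
  have hn : n < ⌊ρ * N⌋₊ + 1 := Nat.lt_succ_iff.2 (Nat.le_floor hnN)
  have hi' := hi.trans_le hpn
  have hj' := hj.trans_le hpn
  have e1 : ∑ k ∈ Finset.range n, distPow q X i j k ω - n * m =
      ∑ k ∈ Finset.range n, (min (distPow q X i j k ω) ((N : ℝ) ^ s) - m) := by
    rw [Finset.sum_sub_distrib]
    simp only [Finset.sum_const, Finset.card_range, nsmul_eq_mul, sub_left_inj]
    refine Finset.sum_congr rfl fun t ht => (min_eq_left ?_).symm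
    exact h1 i hi' j hj' hij t ((Finset.mem_range.1 ht).trans hn)
  rw [← Finset.sum_range_add_sum_Ico (fun k => min (distPow q X i j k ω) ((N : ℝ) ^ s) - m) hNn] at e1
  have e2 := h2 i hi' j hj' hij
  have e3 := h3 i hi' j hj' hij n hn
  have e4 : y * sqrtMulLog N ≤ y * sqrtMulLog n := by
    have := sqrtMulLog_le hN1 hNn
    gcongr
  linarith

/-- Almost surely, eventually some centred sum is above `y √(n log n)`, if `y² < 4 τ v`. -/
theorem ae_eventually_exists_le_sum (h : IsIIDArray X μ) {q s r y τ c v m : ℝ} {p : ℕ → ℕ}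
    (hX : MemLp (distPow q X 0 1 0) 2 μ) (hm : ∫ ω, distPow q X 0 1 0 ω ∂μ = m)
    (hv : variance (distPow q X 0 1 0) μ = v) (hv0 : 0 < v)
    (hcov : covariance (distPow q X 0 1 0) (distPow q X 0 2 0) μ < v / 3)
    (hr : 0 < r) (hXr : Integrable (fun ω => distPow q X 0 1 0 ω ^ r) μ)
    (hs0 : 0 < s) (hs : s < 1 / 2) (hsr : 2 * τ + 1 < s * r) (hτ : 0 < τ) (hc : 0 < c)
    (hp : ∀ n : ℕ, 1 ≤ n → c * (n : ℝ) ^ τ ≤ p n)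
    (hy : 0 < y) (hyτ : y ^ 2 / (2 * v) < 2 * τ) :
    ∀ᵐ ω ∂μ, ∀ᶠ n : ℕ in atTop, ∃ i j, i < j ∧ j < p n ∧
      n * m + y * sqrtMulLog n ≤ ∑ k ∈ Finset.range n, distPow q X i j k ω := by
  obtain ⟨y', hyy', hy'⟩ : ∃ y', y < y' ∧ y' ^ 2 / (2 * v) < 2 * τ := by
    rw [div_lt_iff₀ (by positivity)] at hyτ
    obtain ⟨y', h1, h2⟩ := exists_between ((Real.lt_sqrt hy.le).2 hyτ)
    refine ⟨y', h1, ?_⟩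
    rw [div_lt_iff₀ (by positivity)]
    exact (Real.lt_sqrt (hy.trans h1).le).1 h2
  have hy'0 : 0 < y' := hy.trans hyy'
  -- The sum up to `N` exceeds its mean at level `y'`, the increment may lose `y' - y₁`, and `ρ ≤ y₁
  -- / y` lets level `y₁` at `N` dominate level `y` at `n`.
  obtain ⟨y₁, hy1, hy2⟩ := exists_between hyy'
  obtain ⟨ρ, hρ, hρ1, hρy⟩ := exists_one_lt_and_lt_div ((one_lt_div hy).2 hy1) (sub_pos.2 hy2) hv0
    (by linarith : 0 < 2 * τ + 1)
  have hρ0 : 0 < ρ := by linarith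
  rw [le_div_iff₀ hy] at hρ1
  have hpow : Tendsto (fun N : ℕ => c / 4 * (N : ℝ) ^ τ) atTop atTop :=
    ((tendsto_rpow_atTop hτ).comp tendsto_natCast_atTop_atTop).const_mul_atTop (by positivity)
  -- Two blocks of `⌊(c / 2) N ^ τ⌋` rows fit among the `p n` available; the constant `c / 4`
  -- absorbs the floor.
  obtain ⟨A, η, hη, hE⟩ := h.exists_eventually_measureReal_forall_notMem_le
    (P := fun N => ⌊c / 2 * (N : ℝ) ^ τ⌋₊) (c := c / 4) hX hm hv hv0 hcov hr hXr hs0 hs hsr.le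
    (by positivity) (by
      filter_upwards [hpow.eventually_ge_atTop 1] with N hN
      have := (Nat.lt_floor_add_one (c / 2 * (N : ℝ) ^ τ)).le
      linarith) hy'0 hy'
  have htend : Tendsto (fun k : ℕ => ⌈ρ ^ k⌉₊) atTop atTop :=
    tendsto_nat_ceil_atTop.comp (tendsto_pow_atTop_atTop_of_one_lt hρ)
  filter_upwards [ae_eventually_notMem_of_measureReal_le_rpow hη hρ hE,
    h.ae_eventually_increment_sub_lt hX hm hv hv0 hτ.le hc.le hρ (sub_pos.2 hy2) hρy] with ω h1 h2
  refine eventually_of_eventually_geometric hρ ?_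
  filter_upwards [h1, h2, htend.eventually (eventually_sqrtMulLog_le_mul hρ)] with k h1 h2 h3 n hNn hnN
  set N := ⌈ρ ^ k⌉₊ with hN
  have hN1 : 1 ≤ N := Nat.one_le_ceil_iff.2 (by positivity)
  simp only [not_forall, not_not] at h1
  obtain ⟨i, hi, j, hj, hij⟩ := h1
  set P := ⌊c / 2 * (N : ℝ) ^ τ⌋₊ with hP
  have hP2 : ((2 * P : ℕ) : ℝ) ≤ c * (N : ℝ) ^ τ := by
    have := Nat.floor_le (a := c / 2 * (N : ℝ) ^ τ) (by positivity)
    push_cast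
    linarith
  have hPp : 2 * P ≤ p n := by
    have : ((2 * P : ℕ) : ℝ) ≤ p n := hP2.trans (le_trans (by gcongr) (hp n (hN1.trans hNn)))
    exact_mod_cast this
  have hPR : 2 * P ≤ ⌈c * (N : ℝ) ^ τ⌉₊ := by
    exact_mod_cast hP2.trans (Nat.le_ceil _)
  refine ⟨i, P + j, by omega, by omega, ?_⟩
  have e1 := h2 i (by omega) (P + j) (by omega) (by omega) n (Nat.lt_succ_iff.2 (Nat.le_floor hnN))
  -- Truncation only lowers the sum, so large terms need no control here.
  have e2 : y' * sqrtMulLog N ≤ ∑ t ∈ Finset.range N, (distPow q X i (P + j) t ω - m) :=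
    le_trans hij (Finset.sum_le_sum fun t _ => sub_le_sub_right (min_le_left _ _) m)
  have e3 : ∑ k ∈ Finset.range n, distPow q X i (P + j) k ω - n * m =
      ∑ t ∈ Finset.range N, (distPow q X i (P + j) t ω - m) -
        ∑ t ∈ Finset.Ico N n, (m - distPow q X i (P + j) t ω) := by
    have : ∑ t ∈ Finset.Ico N n, (m - distPow q X i (P + j) t ω) =
        -∑ t ∈ Finset.Ico N n, (distPow q X i (P + j) t ω - m) := by
      rw [← Finset.sum_neg_distrib]
      exact Finset.sum_congr rfl fun _ _ => by ring
    rw [this, sub_neg_eq_add, Finset.sum_range_add_sum_Ico _ hNn, Finset.sum_sub_distrib]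
    simp
  have e4 : y * sqrtMulLog n ≤ y₁ * sqrtMulLog N := by
    calc y * sqrtMulLog n ≤ y * (ρ * sqrtMulLog N) := by
          gcongr
          exact h3 n (hN1.trans hNn) hnN
      _ = ρ * y * sqrtMulLog N := by ring
      _ ≤ _ := by
          have := sqrtMulLog_nonneg N
          gcongr
  linarith

end IsIIDArray

/-! ### From sums to the maximum, and the normalisation. -/

theorem maxInterpointDist_rpow_le {p n : ℕ} {q B : ℝ} (hq : 0 < q) (hB : 0 ≤ B)
    {A : Matrix (Fin p) (Fin n) ℝ}
    (h : ∀ i j : Fin p, i < j → ∑ k, |A i k - A j k| ^ q ≤ B) :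
    maxInterpointDist q A ^ q ≤ B := by
  -- With fewer than two rows the supremum is over an empty type and equals `0`; `0 ≤ B` covers that
  -- case.
  have h0 : 0 ≤ maxInterpointDist q A := Real.iSup_nonneg fun ij =>
    Real.rpow_nonneg (Finset.sum_nonneg fun k _ => Real.rpow_nonneg (abs_nonneg _) _) _
  have h1 : maxInterpointDist q A ≤ B ^ (1 / q) := by
    refine Real.iSup_le (fun ij => ?_) (by positivity)
    exact Real.rpow_le_rpow (Finset.sum_nonneg fun k _ => Real.rpow_nonneg (abs_nonneg _) _)
      (h _ _ ij.2) (by positivity)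
  calc maxInterpointDist q A ^ q ≤ (B ^ (1 / q)) ^ q := Real.rpow_le_rpow h0 h1 hq.le
    _ = B := by rw [← Real.rpow_mul hB, one_div_mul_cancel hq.ne', Real.rpow_one]

theorem sum_le_maxInterpointDist_rpow {p n : ℕ} {q : ℝ} (hq : 0 < q)
    (A : Matrix (Fin p) (Fin n) ℝ) {i j : Fin p} (hij : i < j) :
    ∑ k, |A i k - A j k| ^ q ≤ maxInterpointDist q A ^ q := by
  have h0 : 0 ≤ ∑ k, |A i k - A j k| ^ q :=
    Finset.sum_nonneg fun k _ => Real.rpow_nonneg (abs_nonneg _) _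
  have h1 : (∑ k, |A i k - A j k| ^ q) ^ (1 / q) ≤ maxInterpointDist q A :=
    le_ciSup (f := fun ij : {ij : Fin p × Fin p // ij.1 < ij.2} =>
      lqNorm q (A ij.1.1 - A ij.1.2)) (Set.finite_range _).bddAbove ⟨(i, j), hij⟩
  calc _ = ((∑ k, |A i k - A j k| ^ q) ^ (1 / q)) ^ q := by
        rw [← Real.rpow_mul h0, one_div_mul_cancel hq.ne', Real.rpow_one]
    _ ≤ _ := Real.rpow_le_rpow (by positivity) h1 hq.le

theorem sum_dataMatrix {Ω : Type*} (q : ℝ) (X : ℕ → ℕ → Ω → ℝ) (p n : ℕ) (ω : Ω) (i j : Fin p) :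
    ∑ k, |dataMatrix X p n ω i k - dataMatrix X p n ω j k| ^ q =
      ∑ k ∈ Finset.range n, distPow q X i j k ω :=
  Fin.sum_univ_eq_sum_range (fun k => distPow q X i j k ω) n

/-- Polynomially growing `p n` has `log (p n) ~ τ log n`. -/
theorem tendsto_log_div_log {p : ℕ → ℕ} {τ c₁ c₂ : ℝ} (hc₁ : 0 < c₁)
    (h₁ : ∀ n : ℕ, 1 ≤ n → c₁ * (n : ℝ) ^ τ ≤ p n) (h₂ : ∀ n : ℕ, 1 ≤ n → (p n : ℝ) ≤ c₂ * (n : ℝ) ^ τ) :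
    Tendsto (fun n : ℕ => Real.log (p n) / Real.log n) atTop (𝓝 τ) := by
  have hlog : Tendsto (fun n : ℕ => Real.log n) atTop atTop :=
    Real.tendsto_log_atTop.comp tendsto_natCast_atTop_atTop
  have hlim : ∀ c : ℝ, Tendsto (fun n : ℕ => Real.log c / Real.log n + τ) atTop (𝓝 τ) := fun c => by
    simpa using (hlog.const_div_atTop (Real.log c)).add_const τ
  have hc₂ : 0 < c₂ := by
    have := (h₁ 1 le_rfl).trans (h₂ 1 le_rfl)
    simp only [Nat.cast_one, Real.one_rpow, mul_one] at this
    linarith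
  have hform : ∀ c : ℝ, 0 < c → ∀ n : ℕ, 2 ≤ n →
      Real.log (c * (n : ℝ) ^ τ) / Real.log n = Real.log c / Real.log n + τ := fun c hc n hn => by
    have hn0 : (0 : ℝ) < n := by exact_mod_cast (by omega : 0 < n)
    have hl : 0 < Real.log n := Real.log_pos (by exact_mod_cast hn)
    rw [Real.log_mul hc.ne' (by positivity), Real.log_rpow hn0]
    field_simp
  refine tendsto_of_tendsto_of_tendsto_of_le_of_le' (hlim c₁) (hlim c₂) ?_ ?_
  · filter_upwards [eventually_ge_atTop 2] with n hn
    have hn0 : (0 : ℝ) < n := by exact_mod_cast (by omega : 0 < n)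
    have hl : 0 < Real.log n := Real.log_pos (by exact_mod_cast hn)
    rw [← hform c₁ hc₁ n hn]
    have := h₁ n (by omega)
    gcongr
  · filter_upwards [eventually_ge_atTop 2] with n hn
    have hn0 : (0 : ℝ) < n := by exact_mod_cast (by omega : 0 < n)
    have hl : 0 < Real.log n := Real.log_pos (by exact_mod_cast hn)
    rw [← hform c₂ hc₂ n hn]
    have h3 := h₂ n (by omega)
    have h4 : (0 : ℝ) < p n := lt_of_lt_of_le (by positivity) (h₁ n (by omega))
    gcongr

/-- Rational levels suffice, so only countably many null sets are discarded. -/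
theorem tendsto_of_forall_rat {w : ℕ → ℝ} {a : ℝ} (ha : 0 < a)
    (hlow : ∀ y : ℚ, 0 < (y : ℝ) → (y : ℝ) < a → ∀ᶠ n in atTop, (y : ℝ) ≤ w n)
    (hup : ∀ y : ℚ, a < (y : ℝ) → ∀ᶠ n in atTop, w n ≤ y) : Tendsto w atTop (𝓝 a) := by
  refine tendsto_order.2 ⟨fun b hb => ?_, fun b hb => ?_⟩
  · obtain ⟨y, h1, h2⟩ := exists_rat_btwn (max_lt hb ha)
    filter_upwards [hlow y ((le_max_right _ _).trans_lt h1) h2] with n hn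
    exact ((le_max_left _ _).trans_lt h1).trans_le hn
  · obtain ⟨y, h1, h2⟩ := exists_rat_btwn hb
    filter_upwards [hup y h1] with n hn
    exact hn.trans_lt h2

theorem sqrt_mul_log_eq {v L : ℝ} {n : ℕ} (hn : 2 ≤ n) :
    Real.sqrt (v * n * L) = sqrtMulLog n * Real.sqrt (v * (L / Real.log n)) := by
  have hl : 0 < Real.log n := Real.log_pos (by exact_mod_cast hn)
  rw [sqrtMulLog, ← Real.sqrt_mul (by positivity)]
  congr 1
  field_simp

theorem theorem4p1 {Ω : Type*} [MeasurableSpace Ω] (μ : Measure Ω) [IsProbabilityMeasure μ]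
    (X : ℕ → ℕ → Ω → ℝ)
    (hmeas : ∀ i k, Measurable (X i k))
    (hindep : iIndepFun (fun ik : ℕ × ℕ => X ik.1 ik.2) μ)
    (hident : ∀ i k, IdentDistrib (X i k) (X 0 0) μ μ)
    (hvar : 0 < variance (X 0 0) μ)
    (q : ℝ) (hq : 1 ≤ q)
    (p : ℕ → ℕ) (τ c₁ c₂ : ℝ) (hτ : 0 < τ) (hc₁ : 0 < c₁)
    (hp : ∀ n : ℕ, 1 ≤ n → c₁ ≤ (p n : ℝ) / (n : ℝ) ^ τ ∧ (p n : ℝ) / (n : ℝ) ^ τ ≤ c₂)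
    (hmoment : ∃ ε : ℝ, 0 < ε ∧ Integrable (fun ω => |X 0 0 ω| ^ (q * (4 * τ + 4 + ε))) μ)
    (hcorr : corr (fun ω => |X 0 0 ω - X 1 0 ω| ^ q) (fun ω => |X 0 0 ω - X 2 0 ω| ^ q) μ < 1 / 3) :
    ∀ᵐ ω ∂μ, Tendsto
      (fun n : ℕ =>
        (maxInterpointDist q (dataMatrix X (p n) n ω) ^ q
            - n * ∫ ω', |X 0 0 ω' - X 1 0 ω'| ^ q ∂μ) /
          Real.sqrt (variance (fun ω' => |X 0 0 ω' - X 1 0 ω'| ^ q) μ * n * Real.log (p n)))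
      atTop (𝓝 2) := by
  have h : IsIIDArray X μ := ⟨hmeas, hindep, hident⟩
  have hq0 : 0 < q := by linarith
  obtain ⟨ε, hε, hint⟩ := hmoment
  have hL := h.memLp_distPow hq0 (by linarith : 0 < 4 * τ + 4 + ε) hint
  have hX : MemLp (distPow q X 0 1 0) 2 μ := hL.mono_exponent (by
    rw [show (2 : ENNReal) = ENNReal.ofReal 2 by norm_num]
    exact ENNReal.ofReal_le_ofReal (by linarith))
  have hr : 0 < 4 * τ + 4 := by linarith
  have hXr : Integrable (fun ω => distPow q X 0 1 0 ω ^ (4 * τ + 4)) μ := by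
    have hL' : MemLp (distPow q X 0 1 0) (ENNReal.ofReal (4 * τ + 4)) μ :=
      hL.mono_exponent (ENNReal.ofReal_le_ofReal (by linarith))
    have := hL'.integrable_norm_rpow (by simpa using hr) ENNReal.ofReal_ne_top
    rw [ENNReal.toReal_ofReal hr.le] at this
    simpa only [Real.norm_of_nonneg (distPow_nonneg q X 0 1 0 _)] using this
  change corr (distPow q X 0 1 0) (distPow q X 0 2 0) μ < 1 / 3 at hcorr
  change ∀ᵐ ω ∂μ, Tendsto (fun n : ℕ => (maxInterpointDist q (dataMatrix X (p n) n ω) ^ q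
    - n * ∫ ω', distPow q X 0 1 0 ω' ∂μ) /
      Real.sqrt (variance (distPow q X 0 1 0) μ * n * Real.log (p n))) atTop (𝓝 2)
  have hv0 := h.variance_distPow_pos hq0 hX hvar
  have hm0 : 0 ≤ ∫ ω', distPow q X 0 1 0 ω' ∂μ := integral_nonneg (distPow_nonneg q X 0 1 0)
  -- Both variables have variance `v`, so the correlation condition becomes covariance below `v /
  -- 3`.
  rw [corr, (h.identDistrib_distPow q (i := 0) (j := 2) (by decide) 0).variance_eq,
    Real.mul_self_sqrt hv0.le, div_lt_iff₀ hv0] at hcorr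
  generalize hm : ∫ ω', distPow q X 0 1 0 ω' ∂μ = m at hm0 ⊢
  generalize hv : variance (distPow q X 0 1 0) μ = v at hv0 hcorr ⊢
  -- This gives `s (4 τ + 4) = 2 τ + 3 / 2`, halfway between the required `2 τ + 1` and the value `2
  -- τ + 2` at `s = 1 / 2`.
  set s := (4 * τ + 3) / (8 * τ + 8) with hs
  have hs0 : 0 < s := by positivity
  have hs1 : s < 1 / 2 := by rw [hs, div_lt_div_iff₀ (by linarith) (by norm_num)]; linarith
  have hsr : 2 * τ + 1 < s * (4 * τ + 4) := by
    have : s * (4 * τ + 4) = 2 * τ + 3 / 2 := by rw [hs]; field_simp; ring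
    linarith
  have hn0 : ∀ n : ℕ, 1 ≤ n → (0 : ℝ) < (n : ℝ) ^ τ := fun n hn =>
    Real.rpow_pos_of_pos (by exact_mod_cast hn) _
  have hp₁ : ∀ n : ℕ, 1 ≤ n → c₁ * (n : ℝ) ^ τ ≤ p n := fun n hn =>
    (le_div_iff₀ (hn0 n hn)).1 (hp n hn).1
  have hp₂ : ∀ n : ℕ, 1 ≤ n → (p n : ℝ) ≤ c₂ * (n : ℝ) ^ τ := fun n hn =>
    (div_le_iff₀ (hn0 n hn)).1 (hp n hn).2
  have hc₂ : 0 ≤ c₂ := hc₁.le.trans ((hp 1 le_rfl).1.trans (hp 1 le_rfl).2)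
  -- The critical level, the solution of `a² / (2 v) = 2 τ`.
  set a := 2 * Real.sqrt (v * τ) with ha
  have ha0 : 0 < a := by positivity
  have hasq : a ^ 2 / (2 * v) = 2 * τ := by
    rw [ha, mul_pow, Real.sq_sqrt (by positivity)]
    field_simp
  have hup : ∀ᵐ ω ∂μ, ∀ y : ℚ, a < y → ∀ᶠ n : ℕ in atTop, ∀ i < p n, ∀ j < p n, i ≠ j →
      ∑ k ∈ Finset.range n, distPow q X i j k ω ≤ n * m + y * sqrtMulLog n := by
    rw [ae_all_iff]
    intro y
    by_cases hy : a < y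
    · filter_upwards [h.ae_eventually_forall_sum_le hX hm hv hv0 hr hXr hs0 hs1 hsr hτ hc₂ hp₂
        (ha0.trans hy) (by rw [← hasq]; gcongr)] with ω hω _
      exact hω
    · exact ae_of_all _ fun ω hy' => absurd hy' hy
  have hlow : ∀ᵐ ω ∂μ, ∀ y : ℚ, 0 < (y : ℝ) → y < a → ∀ᶠ n : ℕ in atTop, ∃ i j, i < j ∧ j < p n ∧
      n * m + y * sqrtMulLog n ≤ ∑ k ∈ Finset.range n, distPow q X i j k ω := by
    rw [ae_all_iff]
    intro y
    by_cases hy : 0 < (y : ℝ) ∧ y < a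
    · filter_upwards [h.ae_eventually_exists_le_sum hX hm hv hv0 (by linarith) hr hXr hs0 hs1 hsr hτ
        hc₁ hp₁ hy.1 (by rw [← hasq]; have := hy.1.le; have := hy.2; gcongr)] with ω hω _ _
      exact hω
    · exact ae_of_all _ fun ω hy' hy'' => absurd ⟨hy', hy''⟩ hy
  filter_upwards [hup, hlow] with ω hω hω'
  have hD : ∀ n : ℕ, 2 ≤ n → 0 < sqrtMulLog n := fun n hn =>
    Real.sqrt_pos.2 (mul_pos (by exact_mod_cast (by omega : 0 < n))
      (Real.log_pos (by exact_mod_cast hn)))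
  have hlim : Tendsto (fun n : ℕ => (maxInterpointDist q (dataMatrix X (p n) n ω) ^ q - n * m) /
      sqrtMulLog n) atTop (𝓝 a) := by
    refine tendsto_of_forall_rat ha0 (fun y hy0 hy => ?_) (fun y hy => ?_)
    · filter_upwards [hω' y hy0 hy, eventually_ge_atTop 2] with n hn hn2
      obtain ⟨i, j, hij, hj, hsum⟩ := hn
      rw [le_div_iff₀ (hD n hn2)]
      have := sum_le_maxInterpointDist_rpow hq0 (dataMatrix X (p n) n ω)
        (i := ⟨i, hij.trans hj⟩) (j := ⟨j, hj⟩) hij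
      rw [sum_dataMatrix] at this
      simp only at this
      linarith
    · filter_upwards [hω y hy, eventually_ge_atTop 2] with n hn hn2
      rw [div_le_iff₀ (hD n hn2)]
      have hy0 : (0 : ℝ) < y := ha0.trans hy
      have := maxInterpointDist_rpow_le (A := dataMatrix X (p n) n ω) hq0
        (B := n * m + y * sqrtMulLog n) (by have := sqrtMulLog_nonneg n; positivity)
        (fun i j hij => by
          rw [sum_dataMatrix]
          exact hn i i.2 j j.2 (fun he => hij.ne (Fin.ext he)))
      linarith
  have hden : Tendsto (fun n : ℕ => Real.sqrt (v * (Real.log (p n) / Real.log n))) atTop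
      (𝓝 (Real.sqrt (v * τ))) :=
    (Real.continuous_sqrt.tendsto _).comp ((tendsto_log_div_log hc₁ hp₁ hp₂).const_mul v)
  have hfin := hlim.div hden (by positivity)
  rw [show a / Real.sqrt (v * τ) = 2 from mul_div_cancel_right₀ 2 (by positivity)] at hfin
  refine hfin.congr' ?_
  filter_upwards [eventually_ge_atTop 2] with n hn
  rw [Pi.div_apply, sqrt_mul_log_eq hn, div_div]
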